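/- Let $n\ge 1$, $N\in\mathbb N$, and let $\mathcal G$ be a directed graph without self-loops on the vertices $0,1,\dots,N$, where $w_{ij}=1$ if node $j$ transfers its information to node $i$ and $w_{ij}=0$ otherwise. Assume that vertex $0$ (the leader) is a root: it receives no information ($w_{0j}=0$ for all $j$), and every vertex $1,\dots,N$ (the followers) can be reached from it by a directed path. The agents have the dynamics $\dot x_i=Ax_i+Bu_i$, $x_i\in\mathbb R^n$, $u_i\in\mathbb R$, $i=0,\dots,N$, $u_0=0$, where $A\in\mathbb R^{n\times n}$ is the upper shift matrix (ones on the first superdiagonal, zeros elsewhere) and $B=(0,\dots,0,1)^\top$. Put $e_i=x_i-x_0$ for $i=1,\dots,N$ and $e=(e_1,\dots,e_N)$. Let $-1\le\mu<\frac1{n-1}$ (for $n=1$: $-1\le\mu<\infty$), $G_{\mathbf d}=\mathrm{diag}\{1-\mu(n-k)\}_{k=1}^n$ and $\mathbf d(s)=\exp(sG_{\mathbf d})$, and let $X\in\mathbb R^{n\times n}$, $Y\in\mathbb R^{1\times n}$ satisfy $$X\succ0,\qquad G_{\mathbf d}X+XG_{\mathbf d}\succ0,\qquad AX+XA^\top-BY-Y^\top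 B^\top\prec0 .$$ Put $P=X^{-1}$, $K=YX^{-1}$ and $\|x\|_P=\sqrt{x^\top Px}$. Let $\|\cdot\|_{\mathbf d}$ be the canonical homogeneous norm induced by $\|\cdot\|_P$: $\|0\|_{\mathbf d}=0$, and for $x\ne0$, $\|x\|_{\mathbf d}=e^{s}$ where $\|\mathbf d(-s)x\|_P=1$. Consider the equations $$v_0=0,\qquad v_i=\frac1{\sum_{j=0}^Nw_{ij}}\sum_{j=0}^Nw_{ij}(x_i-x_j+v_j),\qquad i=1,\dots,N, \tag{1}$$ $$u_i=-\|v_i\|_{\mathbf d}^{1+\mu}\,K\,\mathbf d(-\ln\|v_i\|_{\mathbf d})\,v_i,\qquad i=1,\dots,N, \tag{2}$$ where the right-hand side of (2) is read as $0$ if $v_i=0$. Then: 1. For every $x\neq0$ the function $s\mapsto\|\mathbf d(s)x\|_P$ is strictly increasing and there is exactly one $s$ with $\|\mathbf d(-s)x\|_P=1$, so that $\|\cdot\|_{\mathbf d}$ is well defined. Moreover $\sum_jw_{ij}>0$ for $i=1,\dots,N$. 2. For all states $x_0,\dots,x_N$, equation (1) has the unique solution $v_0=0$, $v_i=e_i$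 ($i=1,\dots,N$), and hence (1), (2) determine the inputs $u_i$ uniquely. With these inputs (and $u_0=0$) the error obeys the closed-loop equation $$\dot e_i=f_i(e):=\left(A-\|e_i\|_{\mathbf d}^{1+\mu}BK\mathbf d(-\ln\|e_i\|_{\mathbf d})\right)e_i,\qquad i=1,\dots,N. \tag{3}$$ 3. System (3) is well posed: for every initial state $e(0)\in\mathbb R^{Nn}$ it has a solution on $[0,\infty)$, and every solution on an interval $[0,T)$ with the same initial state coincides with it on $[0,T)$. 4. If $\mu\in[-1,0)$, then (3) is globally finite-time stable: the origin is Lyapunov stable, and there is a settling-time function $T:\mathbb R^{Nn}\to(0,\infty)$ such that every solution on $[0,\infty)$ satisfies $e(t)=0$ for all $t\ge T(e(0))$. Here solutions are classical if $\mu\neq-1$; if $\mu=-1$, where $f$ is discontinuous, they are Filippov solutions, i.e. locally absolutely continuous functions with $\dot e(t)\in\bigcap_{\delta>0}\bigcap_{|S|=0}\overline{\mathrm{co}}\,f(B(e(t),\delta)\setminus S)$ for almost every $t$. -/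

import Mathlib

open MeasureTheory

noncomputable section

namespace LeaderFollowing

/-! ### Communication graph: vertex `0` is the leader, vertices `i.succ` are the followers -/

/-- `r` is a root of the directed graph `G`, where `G.Adj i j` means that node `j` transfers its
information to node `i`: there is a directed path from `r` to every other node, and `r` receives
no information. -/
def IsRoot {V : Type*} (G : Digraph V) (r : V) : Prop :=
  (∀ i, i ≠ r → Relation.TransGen (fun a b => G.Adj b a) r i) ∧ ∀ j, ¬ G.Adj r j

open Classical in
/-- Entry `w i j` of the weighted adjacency matrix. -/
def weight {V : Type*} (G : Digraph V) (i j : V) : ℝ := if G.Adj i j then 1 else 0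

/-! ### Agent dynamics `ẋ = A x + B u` (integrator chain) -/

/-- The upper shift matrix `A`. -/
def matA (n : ℕ) : Matrix (Fin n) (Fin n) ℝ :=
  Matrix.of fun i j => if (j : ℕ) = (i : ℕ) + 1 then 1 else 0

/-- The column `B = (0, …, 0, 1)ᵀ`. -/
def matB (n : ℕ) : Matrix (Fin n) (Fin 1) ℝ :=
  Matrix.of fun i _ => if (i : ℕ) + 1 = n then 1 else 0

/-- The right-hand side `A x + B u` of the dynamics of one agent with scalar input `u`. -/
def agentField (n : ℕ) (x : Fin n → ℝ) (u : ℝ) : Fin n → ℝ :=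
  Matrix.mulVec (matA n) x + Matrix.mulVec (matB n) (fun _ => u)

/-! ### Dilation and canonical homogeneous norm -/

/-- The generator `diag {1 - μ (n - k)}`, `k = 1, …, n` (here `k` is the index plus one). -/
def genG (n : ℕ) (μ : ℝ) : Matrix (Fin n) (Fin n) ℝ :=
  Matrix.diagonal fun k => 1 - μ * ((n : ℝ) - ((k : ℕ) + 1 : ℝ))

/-- The linear dilation `d(s) = exp (s G_d)`. -/
def dil (n : ℕ) (μ s : ℝ) : Matrix (Fin n) (Fin n) ℝ := NormedSpace.exp (s • genG n μ)

/-- The weighted Euclidean norm `‖x‖_P = √(xᵀ P x)`. -/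
def wnorm {n : ℕ} (P : Matrix (Fin n) (Fin n) ℝ) (x : Fin n → ℝ) : ℝ :=
  Real.sqrt (dotProduct x (Matrix.mulVec P x))

/-- The canonical homogeneous norm induced by `‖·‖_P`: `‖0‖_d = 0`, and `‖x‖_d = exp s` where
`‖d(-s) x‖_P = 1`. -/
def hnorm {n : ℕ} (μ : ℝ) (P : Matrix (Fin n) (Fin n) ℝ) (x : Fin n → ℝ) : ℝ :=
  open Classical in
  if x = 0 then 0
  else Real.exp (Classical.epsilon fun s : ℝ => wnorm P (Matrix.mulVec (dil n μ (-s)) x) = 1)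

/-! ### The LMI, the transmitted vectors and the protocol -/

/-- `(X, Y)` solves `X ≻ 0`, `G_d X + X G_d ≻ 0`, `A X + X Aᵀ - B Y - Yᵀ Bᵀ ≺ 0`. -/
def SolvesLMI (n : ℕ) (μ : ℝ) (X : Matrix (Fin n) (Fin n) ℝ) (Y : Matrix (Fin 1) (Fin n) ℝ) :
    Prop :=
  X.PosDef ∧ (genG n μ * X + X * genG n μ).PosDef ∧
    (-(matA n * X + X * (matA n).transpose - matB n * Y
      - Y.transpose * (matB n).transpose)).PosDef

/-- The algebraic equations for the transmitted vectors: `v₀ = 0` and, for the followers,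
`vᵢ = (∑ⱼ wᵢⱼ)⁻¹ ∑ⱼ wᵢⱼ (xᵢ - xⱼ + vⱼ)`. -/
def TransmittedEq {n N : ℕ} (G : Digraph (Fin (N + 1))) (x v : Fin (N + 1) → Fin n → ℝ) : Prop :=
  v 0 = 0 ∧ ∀ i : Fin N, v i.succ =
    (1 / ∑ j, weight G i.succ j) • ∑ j, weight G i.succ j • (x i.succ - x j + v j)

/-- The equations for the inputs: `u₀ = 0` (leader) and, for the followers,
`uᵢ = -‖vᵢ‖_d ^ (1 + μ) K d(-ln ‖vᵢ‖_d) vᵢ`. -/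
def ProtocolEq {n N : ℕ} (μ : ℝ) (K : Matrix (Fin 1) (Fin n) ℝ) (P : Matrix (Fin n) (Fin n) ℝ)
    (v : Fin (N + 1) → Fin n → ℝ) (u : Fin (N + 1) → ℝ) : Prop :=
  u 0 = 0 ∧ ∀ i : Fin N, u i.succ =
    -((hnorm μ P (v i.succ)) ^ (1 + μ) *
      Matrix.mulVec (K * dil n μ (-Real.log (hnorm μ P (v i.succ)))) (v i.succ) 0)

/-- The closed-loop error field
`f(e)ᵢ = (A - ‖eᵢ‖_d ^ (1 + μ) B K d(-ln ‖eᵢ‖_d)) eᵢ`, `e = (e₁, …, e_N)`. -/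
def errorField (n N : ℕ) (μ : ℝ) (K : Matrix (Fin 1) (Fin n) ℝ) (P : Matrix (Fin n) (Fin n) ℝ)
    (e : Fin N → Fin n → ℝ) : Fin N → Fin n → ℝ := fun i =>
  Matrix.mulVec
    (matA n - (hnorm μ P (e i)) ^ (1 + μ) •
      (matB n * K * dil n μ (-Real.log (hnorm μ P (e i))))) (e i)

/-! ### Solutions and stability of `ė = f(e)` -/

section Solutions

variable {E : Type*} [NormedAddCommGroup E] [NormedSpace ℝ E] [MeasureSpace E]

/-- The Filippov set-valued regularization of `f`: intersection, over all `δ > 0` and all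
Lebesgue-null sets `S`, of the closed convex hull of the image under `f` of `B(x, δ) \ S`. -/
def filippov (f : E → E) (x : E) : Set E :=
  ⋂ (δ : ℝ) (_ : 0 < δ) (S : Set E) (_ : volume S = 0),
    closure (convexHull ℝ (f '' (Metric.ball x δ \ S)))

/-- `y` is a Filippov solution of `ẏ = f(y)` on the interval `J`: it is locally absolutely
continuous on `J` and its derivative lies in the Filippov set for almost every time. -/
def IsFilippovSolutionOn (f : E → E) (y : ℝ → E) (J : Set ℝ) : Prop :=
  (∀ a b, a ≤ b → Set.Icc a b ⊆ J → AbsolutelyContinuousOnInterval y a b) ∧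
    ∀ᵐ t : ℝ, t ∈ J → ∃ w ∈ filippov f (y t), HasDerivAt y w t

/-- Solutions on `J` of a homogeneous system of degree `μ`: classical solutions if `μ ≠ -1`,
Filippov solutions if `μ = -1` (where the field is discontinuous). -/
def IsSolutionOn (μ : ℝ) (f : E → E) (y : ℝ → E) (J : Set ℝ) : Prop :=
  (μ ≠ -1 → IsIntegralCurveOn y (fun _ => f) J) ∧ (μ = -1 → IsFilippovSolutionOn f y J)

/-- Every initial state is the start of a solution on `[0, ∞)`, and every solution on some
`[0, T)` with the same initial state coincides with it there. -/
def WellPosed (μ : ℝ) (f : E → E) : Prop :=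
  ∀ y₀ : E, ∃ y : ℝ → E, y 0 = y₀ ∧ IsSolutionOn μ f y (Set.Ici 0) ∧
    ∀ (T : ℝ) (z : ℝ → E), 0 < T → z 0 = y₀ → IsSolutionOn μ f z (Set.Ico 0 T) →
      ∀ t ∈ Set.Ico 0 T, z t = y t

/-- Global finite-time stability of the origin: Lyapunov stability, and a settling-time function
after which every solution is at the origin. -/
def GloballyFiniteTimeStable (μ : ℝ) (f : E → E) : Prop :=
  (∀ ε > 0, ∃ δ > 0, ∀ y : ℝ → E, IsSolutionOn μ f y (Set.Ici 0) → ‖y 0‖ < δ →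
    ∀ t, 0 ≤ t → ‖y t‖ < ε) ∧
  ∃ T : E → ℝ, (∀ y₀, 0 < T y₀) ∧ ∀ y : ℝ → E, IsSolutionOn μ f y (Set.Ici 0) →
    ∀ t, T (y 0) ≤ t → y t = 0

end Solutions

end LeaderFollowing

end

/-!
By (1), the difference of `v i` and `x i - x 0` is the average of its values at the in-neighbours
of `i`, and it vanishes at the leader. By the maximum principle it vanishes
everywhere, so the followers decouple: each error obeys one and the same homogeneous equation
`ẋ = ρ ^ μ • d(ln ρ) M d(-ln ρ) x`, where `ρ = ‖x‖_d` and `M = A - BK`.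

Congruence with `P = X⁻¹` turns the matrix inequalities into the statements that `‖·‖_P` increases
along the dilation `d` and decreases along `M`. The former gives homogeneous polar coordinates
`x = d(ln ρ) z` with `‖z‖_P = 1`. In these, `z` moves on the compact unit sphere and
`ρ' = -c(z) ρ ^ (1 + μ)` with `c` bounded below by a positive constant, which yields Lyapunov
stability and, for `μ < 0`, a finite settling time.

Off the origin the field is `C¹`, whence local uniqueness; solutions are obtained by first solving
for the angle `z` in the rescaled time `dτ = ρ ^ μ dt` and then integrating the equation for `ρ`.
For `μ = -1` the field jumps at the origin, but it is odd, so `0` is a mean of nearby values and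
the constant `0` is a Filippov solution.
-/

noncomputable section

namespace LeaderFollowing

open Set Filter Topology Matrix
open scoped NNReal

section Analysis

variable {E : Type*} [NormedAddCommGroup E] [NormedSpace ℝ E]

lemma exists_le_mul_of_homogeneous [ProperSpace E] {k : ℕ} (hk : k ≠ 0) {Q₁ Q₂ : E → ℝ}
    (h₁ : Continuous Q₁) (h₂ : Continuous Q₂)
    (hom₁ : ∀ c : ℝ, 0 ≤ c → ∀ x, Q₁ (c • x) = c ^ k * Q₁ x)
    (hom₂ : ∀ c : ℝ, 0 ≤ c → ∀ x, Q₂ (c • x) = c ^ k * Q₂ x) (pos : ∀ x, x ≠ 0 → 0 < Q₂ x) :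
    ∃ C > 0, ∀ x, Q₁ x ≤ C * Q₂ x := by
  have hne : ∀ x ∈ Metric.sphere (0 : E) 1, x ≠ 0 :=
    fun x hx => ne_zero_of_mem_unit_sphere ⟨x, hx⟩
  obtain ⟨C, hC⟩ := (isCompact_sphere (0 : E) 1).exists_bound_of_continuousOn
    (h₁.continuousOn.div h₂.continuousOn fun x hx => (pos x (hne x hx)).ne')
  refine ⟨max C 1, by positivity, fun x => ?_⟩
  rcases eq_or_ne x 0 with rfl | hx
  · have hzero : ∀ Q : E → ℝ, (∀ c : ℝ, 0 ≤ c → ∀ x, Q (c • x) = c ^ k * Q x) → Q 0 = 0 :=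
      fun Q hom => by simpa [hk] using hom 0 le_rfl 0
    simp [hzero Q₁ hom₁, hzero Q₂ hom₂]
  · obtain ⟨u, hu, hxu⟩ : ∃ u ∈ Metric.sphere (0 : E) 1, x = ‖x‖ • u :=
      ⟨‖x‖⁻¹ • x, by simp [norm_smul, hx], by simp [smul_smul, hx]⟩
    have hle : Q₁ u ≤ max C 1 * Q₂ u := by
      rw [← div_le_iff₀ (pos u (hne u hu))]
      exact ((le_abs_self _).trans (hC u hu)).trans (le_max_left _ _)
    rw [hxu, hom₁ _ (norm_nonneg x), hom₂ _ (norm_nonneg x), mul_left_comm]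
    gcongr

lemma image_le_of_deriv_nonpos_of_lt {f : ℝ → ℝ} {a b : ℝ} (hab : a ≤ b)
    (hf : ContinuousOn f (Icc a b))
    (hd : ∀ t ∈ Ioo a b, f a < f t → DifferentiableAt ℝ f t ∧ deriv f t ≤ 0) : f b ≤ f a := by
  have hcompact : IsCompact (Icc a b ∩ f ⁻¹' Iic (f a)) := isCompact_Icc.of_isClosed_subset
    (hf.preimage_isClosed_of_isClosed isClosed_Icc isClosed_Iic) inter_subset_left
  obtain ⟨c, ⟨hc, hfc⟩, hlast⟩ := hcompact.exists_isGreatest ⟨a, left_mem_Icc.2 hab, le_refl (f a)⟩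
  have habove : ∀ t ∈ Ioo c b, t ∈ Ioo a b ∧ f a < f t := fun t ht =>
    ⟨⟨hc.1.trans_lt ht.1, ht.2⟩, lt_of_not_ge fun hle =>
      ht.1.not_ge (hlast ⟨⟨hc.1.trans ht.1.le, ht.2.le⟩, hle⟩)⟩
  have hanti : AntitoneOn f (Icc c b) := by
    refine antitoneOn_of_deriv_nonpos (convex_Icc c b) (hf.mono (Icc_subset_Icc_left hc.1)) ?_ ?_
    all_goals
      intro t ht
      rw [interior_Icc] at ht
      obtain ⟨htab, hlt⟩ := habove t ht
    · exact (hd t htab hlt).1.differentiableWithinAt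
    · exact (hd t htab hlt).2
  exact (hanti (left_mem_Icc.2 hc.2) (right_mem_Icc.2 hc.2) hc.2).trans hfc

lemma absolutelyContinuousOnInterval_of_norm_deriv_right_le {y y' : ℝ → E} {a b C : ℝ}
    (hab : a ≤ b) (hy : ContinuousOn y (Icc a b))
    (hd : ∀ t ∈ Icc a b, HasDerivWithinAt y (y' t) (Ici t) t) (hC : ∀ t ∈ Icc a b, ‖y' t‖ ≤ C) :
    AbsolutelyContinuousOnInterval y a b := by
  have hC0 : 0 ≤ C := (norm_nonneg _).trans (hC a (left_mem_Icc.2 hab))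
  have hdist : ∀ u ∈ Icc a b, ∀ v ∈ Icc a b, u ≤ v → dist (y u) (y v) ≤ C * dist u v := by
    intro u hu v hv huv
    have hsub : Icc u v ⊆ Icc a b := Icc_subset_Icc hu.1 hv.2
    have hle := norm_image_sub_le_of_norm_deriv_right_le_segment (hy.mono hsub)
      (fun t ht => hd t (hsub (Ico_subset_Icc_self ht)))
      (fun t ht => hC t (hsub (Ico_subset_Icc_self ht))) v (right_mem_Icc.2 huv)
    rwa [dist_comm, dist_eq_norm, dist_comm, Real.dist_eq, abs_of_nonneg (sub_nonneg.2 huv)]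
  have hlip : LipschitzOnWith C.toNNReal y (uIcc a b) := by
    rw [uIcc_of_le hab]
    refine LipschitzOnWith.of_dist_le_mul fun u hu v hv => ?_
    rw [Real.coe_toNNReal _ hC0]
    rcases le_total u v with h | h
    · exact hdist u hu v hv h
    · rw [dist_comm, dist_comm u]
      exact hdist v hv u hu h
  exact hlip.absolutelyContinuousOnInterval

variable [CompleteSpace E]

lemma exists_hasDerivAt_Ioo_of_lipschitzWith {v : E → E} {K C : ℝ≥0} (hv : LipschitzWith K v)
    (hC : ∀ x, ‖v x‖ ≤ C) (x : E) {a : ℝ} (ha : 0 < a) :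
    ∃ γ : ℝ → E, γ 0 = x ∧ ∀ t ∈ Ioo (-a) a, HasDerivAt γ (v (γ t)) t := by
  have hPL : IsPicardLindelof (fun _ => v) (tmin := -a) (tmax := a)
      ⟨0, by constructor <;> linarith⟩ x (C * a.toNNReal) 0 C K :=
    { lipschitzOnWith := fun _ _ => hv.lipschitzOnWith
      continuousOn := fun _ _ => continuousOn_const
      norm_le := fun _ _ y _ => hC y
      mul_max_le := by simp [ha.le] }
  obtain ⟨γ, h0, hγ⟩ := hPL.exists_eq_forall_mem_Icc_hasDerivWithinAt₀
  exact ⟨γ, h0, fun t ht =>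
    (hγ t (Ioo_subset_Icc_self ht)).hasDerivAt (Icc_mem_nhds ht.1 ht.2)⟩

theorem exists_isIntegralCurve_of_lipschitzWith {v : E → E} {K C : ℝ≥0} (hv : LipschitzWith K v)
    (hC : ∀ x, ‖v x‖ ≤ C) (x : E) : ∃ γ : ℝ → E, γ 0 = x ∧ IsIntegralCurve γ fun _ => v := by
  choose! γ hγ0 hγ using fun a : ℝ => exists_hasDerivAt_Ioo_of_lipschitzWith hv hC x (a := a)
  have hagree : ∀ {a b : ℝ}, 0 < a → a ≤ b → EqOn (γ a) (γ b) (Ioo (-a) a) := fun {a b} ha hab =>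
    ODE_solution_unique_of_mem_Ioo (v := fun _ => v) (s := fun _ => univ)
      (fun _ _ => hv.lipschitzOnWith) ⟨by linarith, ha⟩
      (fun t ht => ⟨hγ a ha t ht, mem_univ _⟩)
      (fun t ht => ⟨hγ b (ha.trans_le hab) t (Ioo_subset_Ioo (neg_le_neg hab) hab ht), mem_univ _⟩)
      (by rw [hγ0 a ha, hγ0 b (ha.trans_le hab)])
  have hpos : ∀ t : ℝ, 0 < |t| + 1 := fun t => by positivity
  have hmem : ∀ t : ℝ, t ∈ Ioo (-(|t| + 1)) (|t| + 1) := fun t => abs_lt.1 (lt_add_one _)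
  refine ⟨fun t => γ (|t| + 1) t, hγ0 _ (hpos 0), fun t => ?_⟩
  refine (hγ _ (hpos t) t (hmem t)).congr_of_eventuallyEq ?_
  filter_upwards [Ioo_mem_nhds (hmem t).1 (hmem t).2] with u hu
  rcases le_total (|t| + 1) (|u| + 1) with h | h
  · exact (hagree (hpos t) h hu).symm
  · exact hagree (hpos u) h (hmem u)

theorem hasDerivWithinAt_of_ae_hasDerivAt {y h : ℝ → E} {a b : ℝ} (hab : a ≤ b)
    (hac : AbsolutelyContinuousOnInterval y a b) (hh : ContinuousOn h (Icc a b))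
    (hd : ∀ᵐ t, t ∈ Icc a b → HasDerivAt y (h t) t) {t : ℝ} (ht : t ∈ Icc a b) :
    HasDerivWithinAt y (h t) (Icc a b) t := by
  obtain ⟨H, hHc, hH⟩ : ∃ H : ℝ → E, Continuous H ∧ EqOn H h (Icc a b) :=
    ⟨IccExtend hab ((Icc a b).domRestrict h),
      (continuousOn_iff_continuous_domRestrict.1 hh).Icc_extend', fun t => IccExtend_of_mem _ _⟩
  let I : ℝ → E := fun t => ∫ u in a..t, H u
  have hI : ∀ t, HasDerivAt I (H t) t := fun t =>
    (hHc.integral_hasStrictDerivAt a t).hasDerivAt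
  have hIC : ContDiff ℝ 1 I := contDiff_one_iff_deriv.2
    ⟨fun t => (hI t).differentiableAt, by rwa [funext fun t => (hI t).deriv]⟩
  obtain ⟨c, hc⟩ := (hac.sub hIC.contDiffOn.absolutelyContinuousOnInterval
    ).const_of_ae_hasDerivAt_zero (by
      filter_upwards [hd] with t hdt hmem
      rw [uIcc_of_le hab] at hmem
      simpa [hH hmem] using (hdt hmem).sub (hI t))
  have hy : ∀ t ∈ Icc a b, y t = c + I t := fun t ht => by
    rw [← hc t (by rwa [uIcc_of_le hab])]
    simp
  rw [← hH ht]
  exact ((hI t).const_add c).hasDerivWithinAt.congr hy (hy t ht)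

lemma exists_time_change {w : ℝ → ℝ} (hw : Continuous w) (hpos : ∀ t, 0 < w t) :
    ∃ e : OpenPartialHomeomorph ℝ ℝ, e.source = univ ∧ Continuous e ∧ StrictMono e ∧ e 0 = 0 ∧
      ∀ t, HasDerivAt e.symm (w t)⁻¹ (e t) := by
  let τ : ℝ → ℝ := fun t => ∫ u in (0 : ℝ)..t, w u
  have hτ : ∀ t, HasStrictDerivAt τ (w t) t := fun t => hw.integral_hasStrictDerivAt 0 t
  have hcont : Continuous τ := continuous_iff_continuousAt.2 fun t => (hτ t).hasDerivAt.continuousAt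
  have hmono : StrictMono τ := strictMono_of_hasDerivAt_pos (fun t => (hτ t).hasDerivAt) hpos
  have hemb : IsOpenEmbedding τ := .of_continuous_injective_isOpenMap hcont hmono.injective
    (isOpenMap_of_hasStrictDerivAt hτ fun t => (hpos t).ne')
  refine ⟨hemb.toOpenPartialHomeomorph τ, rfl, hcont, hmono, by simp [τ], fun t => ?_⟩
  refine OpenPartialHomeomorph.hasDerivAt_symm _ (by simp) (hpos t).ne' ?_
  rw [OpenPartialHomeomorph.left_inv _ (by simp)]
  exact (hτ t).hasDerivAt

end Analysis

section SolutionsOffZero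

/-- Once `y` has reached the origin at a time in `J`, it stays there. This replaces the Lipschitz
condition at the origin in the uniqueness of solutions. -/
def StaysAtZeroOn {E : Type*} [Zero E] (y : ℝ → E) (J : Set ℝ) : Prop :=
  ∀ s ∈ J, ∀ t ∈ J, s ≤ t → y s = 0 → y t = 0

variable {E : Type*} [NormedAddCommGroup E] [NormedSpace ℝ E] {g : E → E} {y z : ℝ → E}
  {J : Set ℝ}

/-- `y` is continuous on `J` and satisfies `ẏ = g(y)` on `J` as long as `y ≠ 0`. Both classical and
Filippov solutions of a field that is continuous off the origin have this property, so uniqueness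
and stability are proved for this common notion. -/
structure IsSolutionOffZeroOn (g : E → E) (y : ℝ → E) (J : Set ℝ) : Prop where
  continuousOn : ContinuousOn y J
  hasDerivWithinAt : ∀ t ∈ J, y t ≠ 0 → HasDerivWithinAt y (g (y t)) J t

namespace IsSolutionOffZeroOn

lemma mono {J' : Set ℝ} (h : IsSolutionOffZeroOn g y J) (hJ : J' ⊆ J) :
    IsSolutionOffZeroOn g y J' :=
  ⟨h.continuousOn.mono hJ, fun t ht hne => (h.hasDerivWithinAt t (hJ ht) hne).mono hJ⟩

lemma hasDerivAt {t : ℝ} (h : IsSolutionOffZeroOn g y J) (hJ : J ∈ 𝓝 t) (hne : y t ≠ 0) :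
    HasDerivAt y (g (y t)) t :=
  (h.hasDerivWithinAt t (mem_of_mem_nhds hJ) hne).hasDerivAt hJ

lemma hasDerivWithinAt_Ici {t : ℝ} (h : IsSolutionOffZeroOn g y J) (hz : StaysAtZeroOn y J)
    (hg : g 0 = 0) (ht : t ∈ J) (hJ : J ∈ 𝓝[≥] t) : HasDerivWithinAt y (g (y t)) (Ici t) t := by
  by_cases hyt : y t = 0
  · rw [hyt, hg]
    refine (hasDerivWithinAt_const t (Ici t) 0).congr_of_eventuallyEq ?_ hyt
    filter_upwards [hJ, self_mem_nhdsWithin] with s hs hts using hz t ht s hs hts hyt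
  · exact (h.hasDerivWithinAt t ht hyt).mono_of_mem_nhdsWithin hJ

lemma ae_hasDerivAt (h : IsSolutionOffZeroOn g y (Ici 0)) (hz : StaysAtZeroOn y (Ici 0))
    (hg : g 0 = 0) : ∀ᵐ t : ℝ, t ∈ Ici 0 → HasDerivAt y (g (y t)) t := by
  have hconvex : Convex ℝ {t : ℝ | 0 ≤ t ∧ y t = 0} :=
    OrdConnected.convex ⟨fun s hs _ _ t ht =>
      ⟨hs.1.trans ht.1, hz s hs.1 t (hs.1.trans ht.1) ht.1 hs.2⟩⟩
  filter_upwards [measure_eq_zero_iff_ae_notMem.1 (hconvex.addHaar_frontier volume),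
    Measure.ae_ne volume 0] with t hfrontier hne ht
  by_cases hyt : y t = 0
  · have hint : {t : ℝ | 0 ≤ t ∧ y t = 0} ∈ 𝓝 t := by
      rw [mem_interior_iff_mem_nhds.symm]
      by_contra hint
      exact hfrontier ⟨subset_closure ⟨ht, hyt⟩, hint⟩
    rw [hyt, hg]
    refine (hasDerivAt_const t 0).congr_of_eventuallyEq ?_
    filter_upwards [hint] with s hs using hs.2
  · exact h.hasDerivAt (Ici_mem_nhds (lt_of_le_of_ne ht hne.symm)) hyt

lemma eventually_eq {a b t : ℝ} (hy : IsSolutionOffZeroOn g y (Icc a b))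
    (hz : IsSolutionOffZeroOn g z (Icc a b)) (ht : t ∈ Ico a b) (heq : y t = z t) (hne : y t ≠ 0)
    (hg : ContDiffAt ℝ 1 g (y t)) : ∀ᶠ u in 𝓝[≥] t, y u = z u := by
  obtain ⟨K, s, hs, hK⟩ := hg.exists_lipschitzOnWith
  have hs0 : s ∩ {0}ᶜ ∈ 𝓝 (y t) := inter_mem hs (isOpen_compl_singleton.mem_nhds hne)
  have hright : Icc a b ∈ 𝓝[≥] t := mem_of_superset (Icc_mem_nhdsGE ht.2) (Icc_subset_Icc_left ht.1)
  have hstay : ∀ {x : ℝ → E}, IsSolutionOffZeroOn g x (Icc a b) → x t = y t →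
      ∀ᶠ u in 𝓝[≥] t, x u ∈ s ∩ {0}ᶜ := fun {x} hx hxt =>
    ((hx.continuousOn t (Ico_subset_Icc_self ht)).mono_of_mem_nhdsWithin hright) (by rwa [hxt])
  obtain ⟨c, htc, hc⟩ := mem_nhdsGE_iff_exists_Icc_subset.1
    ((hstay hy rfl).and ((hstay hz heq.symm).and hright))
  have hsub : Icc t c ⊆ Icc a b := fun u hu => (hc hu).2.2
  have hderiv : ∀ {x : ℝ → E}, IsSolutionOffZeroOn g x (Icc a b) → ∀ u ∈ Ico t c, x u ≠ 0 →
      HasDerivWithinAt x (g (x u)) (Ici u) u := fun {x} hx u hu hxu =>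
    (hx.hasDerivWithinAt u (hsub (Ico_subset_Icc_self hu)) hxu).mono_of_mem_nhdsWithin
      (mem_of_superset (Icc_mem_nhdsGE hu.2) ((Icc_subset_Icc_left hu.1).trans hsub))
  have heqOn : EqOn y z (Icc t c) := ODE_solution_unique_of_mem_Icc_right
    (v := fun _ => g) (s := fun _ => s) (fun _ _ => hK)
    (hy.continuousOn.mono hsub) (fun u hu => hderiv hy u hu (hc (Ico_subset_Icc_self hu)).1.2)
    (fun u hu => (hc (Ico_subset_Icc_self hu)).1.1)
    (hz.continuousOn.mono hsub) (fun u hu => hderiv hz u hu (hc (Ico_subset_Icc_self hu)).2.1.2)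
    (fun u hu => (hc (Ico_subset_Icc_self hu)).2.1.1) heq
  filter_upwards [Icc_mem_nhdsGE htc] with u hu using heqOn hu

theorem eqOn {a b : ℝ} (hg : ∀ x, x ≠ 0 → ContDiffAt ℝ 1 g x)
    (hy : IsSolutionOffZeroOn g y (Icc a b)) (hz : IsSolutionOffZeroOn g z (Icc a b))
    (hy0 : StaysAtZeroOn y (Icc a b)) (hz0 : StaysAtZeroOn z (Icc a b)) (ha : y a = z a) :
    EqOn y z (Icc a b) := by
  have hclosed : IsClosed ({t | y t = z t} ∩ Icc a b) := by
    rw [inter_comm]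
    exact (hy.continuousOn.prodMk hz.continuousOn).preimage_isClosed_of_isClosed isClosed_Icc
      isClosed_diagonal
  refine hclosed.Icc_subset_of_forall_mem_nhdsWithin ha fun t ⟨heq, ht⟩ => ?_
  have hmem := Ico_subset_Icc_self ht
  by_cases hne : y t = 0
  · filter_upwards [Ioc_mem_nhdsGT ht.2] with u hu
    have hub : u ∈ Icc a b := ⟨ht.1.trans hu.1.le, hu.2⟩
    exact (hy0 t hmem u hub hu.1.le hne).trans
      (hz0 t hmem u hub hu.1.le (heq.symm.trans hne)).symm
  · exact (hy.eventually_eq hz ht heq hne (hg _ hne)).filter_mono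
      (nhdsWithin_mono t Ioi_subset_Ici_self)

variable [CompleteSpace E]

theorem of_ae_hasDerivAt {a b : ℝ} (hab : a ≤ b) (hg : ∀ x, x ≠ 0 → ContinuousAt g x)
    (hac : AbsolutelyContinuousOnInterval y a b)
    (hd : ∀ᵐ t, t ∈ Icc a b → y t ≠ 0 → HasDerivAt y (g (y t)) t) :
    IsSolutionOffZeroOn g y (Icc a b) := by
  have hyc : ContinuousOn y (Icc a b) := by simpa [uIcc_of_le hab] using hac.continuousOn
  refine ⟨hyc, fun t ht hne => ?_⟩
  obtain ⟨δ, hδ, hball⟩ := (nhdsWithin_hasBasis Metric.nhds_basis_closedBall _).mem_iff.1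
    ((hyc t ht).eventually_ne hne)
  have hnhds : Metric.closedBall t δ ∩ Icc a b ∈ 𝓝[Icc a b] t :=
    inter_mem (mem_nhdsWithin_of_mem_nhds (Metric.closedBall_mem_nhds t hδ)) self_mem_nhdsWithin
  have htmem : t ∈ Metric.closedBall t δ ∩ Icc a b := ⟨Metric.mem_closedBall_self hδ.le, ht⟩
  refine HasDerivWithinAt.mono_of_mem_nhdsWithin ?_ hnhds
  have hsub : Metric.closedBall t δ ∩ Icc a b ⊆ Icc a b := inter_subset_right
  rw [Real.closedBall_eq_Icc, Icc_inter_Icc] at hball htmem hsub ⊢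
  have hle := htmem.1.trans htmem.2
  refine hasDerivWithinAt_of_ae_hasDerivAt (h := fun t => g (y t)) hle
    (hac.mono (by rwa [uIcc_of_le hle, uIcc_of_le hab]))
    (fun s hs => (hg _ (hball hs)).comp_continuousWithinAt ((hyc.mono hsub) s hs)) ?_ htmem
  filter_upwards [hd] with s hds hs using hds (hsub hs) (hball hs)

end IsSolutionOffZeroOn

theorem exists_isSolutionOffZeroOn_of_time_change {γ : ℝ → E} {w : ℝ → ℝ} (hw : Continuous w)
    (hpos : ∀ t, 0 < w t) (hγ : ∀ t, HasDerivAt γ (w t • g (γ t)) t)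
    (hlim : Tendsto γ atTop (𝓝 0)) : ∃ y, y 0 = γ 0 ∧ IsSolutionOffZeroOn g y (Ici 0) := by
  classical
  obtain ⟨e, hsource, hcont, hmono, he0, hsymm⟩ := exists_time_change hw hpos
  have hleft : ∀ t, e.symm (e t) = t := fun t => e.left_inv (by simp [hsource])
  have htarget : ∀ t, e t ∈ e.target := fun t => e.map_source (by simp [hsource])
  let y : ℝ → E := fun u => if u ∈ e.target then γ (e.symm u) else 0
  have hy : ∀ t, y (e t) = γ t := fun t => by simp [y, htarget, hleft]
  have hin : ∀ u ∈ e.target, HasDerivAt y (g (y u)) u := by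
    intro u hu
    obtain ⟨t, rfl⟩ : ∃ t, e t = u := ⟨e.symm u, e.right_inv hu⟩
    have hcomp : HasDerivAt (γ ∘ e.symm) ((w t)⁻¹ • w t • g (γ t)) (e t) :=
      HasDerivAt.scomp (e t) (by rw [hleft]; exact hγ t) (hsymm t)
    rw [smul_smul, inv_mul_cancel₀ (hpos t).ne', one_smul, ← hy] at hcomp
    refine hcomp.congr_of_eventuallyEq ?_
    filter_upwards [e.open_target.mem_nhds hu] with v hv
    simp [y, hv]
  have hout : ∀ u, 0 ≤ u → u ∉ e.target → ContinuousAt y u := by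
    intro u hu hut
    have hlt : ∀ t, e t < u := fun t => lt_of_not_ge fun hle => by
      obtain ⟨s, rfl⟩ := mem_range_of_exists_le_of_exists_ge hcont ⟨0, he0.trans_le hu⟩ ⟨t, hle⟩
      exact hut (htarget s)
    rw [ContinuousAt, show y u = 0 from if_neg hut, tendsto_def]
    intro V hV
    obtain ⟨T, hT⟩ := eventually_atTop.1 (hlim hV)
    filter_upwards [Ioi_mem_nhds (hlt T)] with v hv
    by_cases hvt : v ∈ e.target
    · rw [← e.right_inv hvt] at hv ⊢
      rw [mem_preimage, hy]
      exact hT _ (hmono.lt_iff_lt.1 hv).le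
    · simpa [y, hvt] using mem_of_mem_nhds hV
  refine ⟨y, by rw [← hy, he0], fun u hu => ?_, fun u _ hne => ?_⟩
  · by_cases hut : u ∈ e.target
    · exact (hin u hut).continuousAt.continuousWithinAt
    · exact (hout u hu hut).continuousWithinAt
  · exact (hin u (by by_contra hut; exact hne (if_neg hut))).hasDerivWithinAt

end SolutionsOffZero

section Filippov

variable {E : Type*} [NormedAddCommGroup E] [NormedSpace ℝ E] [MeasureSpace E]

lemma apply_eq_of_mem_filippov {F : Type*} [NormedAddCommGroup F] [NormedSpace ℝ F]
    {f : E → E} {e w : E} (hw : w ∈ filippov f e) (L : E →L[ℝ] F)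
    (hL : ContinuousAt (fun z => L (f z)) e) : L w = L (f e) := by
  refine eq_of_forall_dist_le fun ε hε => ?_
  obtain ⟨δ, hδ, h⟩ := Metric.continuousAt_iff.1 hL ε hε
  have hhull := mem_iInter₂.1 (mem_iInter₂.1 hw δ hδ) ∅ measure_empty
  refine closure_minimal (convexHull_min ?_ ((convex_closedBall (L (f e)) ε).linear_preimage
    L.toLinearMap)) (Metric.isClosed_closedBall.preimage L.continuous) hhull
  rintro _ ⟨z, ⟨hz, -⟩, rfl⟩
  exact (h hz).le

lemma mem_filippov_of_tendsto_midpoint [(volume : Measure E).IsOpenPosMeasure] {f φ : E → E}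
    {e w : E} (hφ : Measure.QuasiMeasurePreserving φ volume volume) (hφe : Tendsto φ (𝓝 e) (𝓝 e))
    (hw : Tendsto (fun z => midpoint ℝ (f z) (f (φ z))) (𝓝 e) (𝓝 w)) : w ∈ filippov f e := by
  refine mem_iInter₂.2 fun δ hδ => mem_iInter₂.2 fun A hA => ?_
  have hnull : ∀ᵐ z, z ∉ A ∧ φ z ∉ A :=
    (measure_eq_zero_iff_ae_notMem.1 hA).and
      (measure_eq_zero_iff_ae_notMem.1 (hφ.preimage_null hA))
  have hball := Metric.ball_mem_nhds e hδ
  refine mem_closure_of_frequently_of_tendsto ?_ hw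
  refine ((mem_closure_iff_frequently.1 (Measure.dense_of_ae hnull e)).and_eventually
    (hφe.eventually_mem hball |>.and hball)).mono ?_
  rintro z ⟨⟨hzA, hφA⟩, hφz, hz⟩
  exact (convex_convexHull ℝ _).midpoint_mem
    (subset_convexHull ℝ _ (mem_image_of_mem f ⟨hz, hzA⟩))
    (subset_convexHull ℝ _ (mem_image_of_mem f ⟨hφz, hφA⟩))

end Filippov

section QuadForm

variable {ι : Type*} [Fintype ι]

/-- The quadratic form `x ↦ xᵀ A x`; `A` is not assumed to be symmetric. -/
def quadForm (A : Matrix ι ι ℝ) (x : ι → ℝ) : ℝ := x ⬝ᵥ A *ᵥ x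

@[simp] lemma quadForm_zero (A : Matrix ι ι ℝ) : quadForm A 0 = 0 := by simp [quadForm]

lemma quadForm_smul (A : Matrix ι ι ℝ) (c : ℝ) (x : ι → ℝ) :
    quadForm A (c • x) = c ^ 2 * quadForm A x := by
  simp only [quadForm, mulVec_smul, dotProduct_smul, smul_dotProduct, smul_eq_mul]
  ring

lemma quadForm_neg_left (A : Matrix ι ι ℝ) (x : ι → ℝ) : quadForm (-A) x = -quadForm A x := by
  simp [quadForm, neg_mulVec]

lemma quadForm_transpose_mul_add_mul (L A : Matrix ι ι ℝ) (x : ι → ℝ) :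
    quadForm (Lᵀ * A + A * L) x = (L *ᵥ x) ⬝ᵥ A *ᵥ x + x ⬝ᵥ A *ᵥ L *ᵥ x := by
  simp only [quadForm, add_mulVec, dotProduct_add, ← mulVec_mulVec, dotProduct_mulVec x,
    vecMul_transpose]

lemma quadForm_pos {A : Matrix ι ι ℝ} (hA : A.PosDef) {x : ι → ℝ} (hx : x ≠ 0) :
    0 < quadForm A x := by
  simpa [quadForm] using hA.dotProduct_mulVec_pos hx

lemma contDiff_mulVec (A : Matrix ι ι ℝ) {n : WithTop ℕ∞} : ContDiff ℝ n (A *ᵥ ·) :=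
  (mulVecLin A).toContinuousLinearMap.contDiff

lemma contDiff_quadForm (A : Matrix ι ι ℝ) {n : WithTop ℕ∞} : ContDiff ℝ n (quadForm A) := by
  unfold quadForm dotProduct
  have hA := contDiff_pi.1 (contDiff_mulVec A (n := n))
  exact ContDiff.sum fun i _ => (contDiff_apply ℝ ℝ i).mul (hA i)

lemma continuous_quadForm (A : Matrix ι ι ℝ) : Continuous (quadForm A) :=
  (contDiff_quadForm A (n := 0)).continuous

lemma hasDerivAt_quadForm (A : Matrix ι ι ℝ) {u : ℝ → ι → ℝ} {u' : ι → ℝ} {t : ℝ}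
    (hu : HasDerivAt u u' t) :
    HasDerivAt (fun t => quadForm A (u t)) (u' ⬝ᵥ A *ᵥ u t + u t ⬝ᵥ A *ᵥ u') t := by
  have hui := hasDerivAt_pi.1 hu
  simp only [quadForm, dotProduct, mulVec, ← Finset.sum_add_distrib]
  exact HasDerivAt.fun_sum fun i _ =>
    (hui i).mul (HasDerivAt.fun_sum fun j _ => (hui j).const_mul (A i j))

lemma exists_quadForm_le (A : Matrix ι ι ℝ) {B : Matrix ι ι ℝ} (hB : B.PosDef) :
    ∃ C > 0, ∀ x, quadForm A x ≤ C * quadForm B x :=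
  exists_le_mul_of_homogeneous two_ne_zero (continuous_quadForm A) (continuous_quadForm B)
    (fun c _ => quadForm_smul A c) (fun c _ => quadForm_smul B c) fun _ => quadForm_pos hB

lemma exists_sq_norm_mulVec_le (A : Matrix ι ι ℝ) {B : Matrix ι ι ℝ} (hB : B.PosDef) :
    ∃ C > 0, ∀ x, ‖A *ᵥ x‖ ^ 2 ≤ C * quadForm B x :=
  exists_le_mul_of_homogeneous two_ne_zero
    ((contDiff_mulVec A (n := 0)).continuous.norm.pow 2) (continuous_quadForm B)
    (fun c _ x => by simp [mulVec_smul, norm_smul, mul_pow]) (fun c _ => quadForm_smul B c)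
    fun _ => quadForm_pos hB

end QuadForm

section Dilation

variable {ι : Type*} [Fintype ι] [DecidableEq ι] {r : ι → ℝ}

/-- The linear dilation `exp (s diag r)` with weights `r`. -/
def dilation (r : ι → ℝ) (s : ℝ) : (ι → ℝ) →ₗ[ℝ] ι → ℝ :=
  (diagonal fun k => Real.exp (s * r k)).mulVecLin

@[simp] lemma dilation_apply (s : ℝ) (x : ι → ℝ) (k : ι) :
    dilation r s x k = Real.exp (s * r k) * x k := by
  simp [dilation, mulVec_diagonal]

@[simp] lemma dilation_zero_left (x : ι → ℝ) : dilation r 0 x = x := by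
  ext; simp

lemma dilation_dilation (s t : ℝ) (x : ι → ℝ) :
    dilation r s (dilation r t x) = dilation r (s + t) x := by
  ext; simp [add_mul, Real.exp_add, mul_assoc]

lemma dilation_ne_zero {s : ℝ} {x : ι → ℝ} (hx : x ≠ 0) : dilation r s x ≠ 0 := by
  refine fun h => hx ?_
  simpa [dilation_dilation] using congrArg (dilation r (-s)) h

lemma diagonal_mulVec_dilation (s : ℝ) (x : ι → ℝ) :
    diagonal r *ᵥ dilation r s x = dilation r s (diagonal r *ᵥ x) := by
  ext; simp [mulVec_diagonal, mul_left_comm]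

lemma contDiffAt_dilation {F : Type*} [NormedAddCommGroup F] [NormedSpace ℝ F] {n : WithTop ℕ∞}
    {s : F → ℝ} {u : F → ι → ℝ} {z : F} (hs : ContDiffAt ℝ n s z) (hu : ContDiffAt ℝ n u z) :
    ContDiffAt ℝ n (fun z => dilation r (s z) (u z)) z := by
  refine contDiffAt_pi.2 fun k => ?_
  simp only [dilation_apply]
  exact (hs.mul contDiffAt_const).exp.mul (contDiffAt_pi.1 hu k)

lemma continuous_dilation {F : Type*} [TopologicalSpace F] {s : F → ℝ} {u : F → ι → ℝ}
    (hs : Continuous s) (hu : Continuous u) : Continuous fun z => dilation r (s z) (u z) := by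
  refine continuous_pi fun k => ?_
  simp only [dilation_apply]
  fun_prop

lemma hasDerivAt_dilation {s : ℝ → ℝ} {s' : ℝ} {u : ℝ → ι → ℝ} {u' : ι → ℝ} {t : ℝ}
    (hs : HasDerivAt s s' t) (hu : HasDerivAt u u' t) :
    HasDerivAt (fun t => dilation r (s t) (u t))
      (dilation r (s t) (s' • diagonal r *ᵥ u t + u')) t := by
  refine hasDerivAt_pi.2 fun k => ?_
  simp only [dilation_apply]
  convert! ((hs.mul_const (r k)).exp).mul (hasDerivAt_pi.1 hu k) using 1
  simp [mulVec_diagonal]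
  ring

end Dilation

/-- The data of a system `ẏ = f(y)` whose field `f` is homogeneous of degree `μ` for the dilation
with weights `r` and agrees with `x ↦ M x` on the unit sphere of the norm `√(xᵀ P x)`. The second
condition makes this norm strictly increasing along the dilation, the third one makes it decrease
along `ẋ = M x`. -/
structure HomogeneousSystem (ι : Type*) [Fintype ι] [DecidableEq ι] where
  /-- The weights of the dilation. -/
  r : ι → ℝ
  /-- The matrix of the norm that is made homogeneous. -/
  P : Matrix ι ι ℝ
  /-- The linear field which `f` equals on the unit sphere. -/
  M : Matrix ι ι ℝ
  /-- The degree of homogeneity. -/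
  μ : ℝ
  posDef : P.PosDef
  posDef_dilation : (diagonal r * P + P * diagonal r).PosDef
  posDef_decay : (-(Mᵀ * P + P * M)).PosDef

namespace HomogeneousSystem

variable {ι : Type*} [Fintype ι] [DecidableEq ι] (S : HomogeneousSystem ι)

/-- The squared norm `xᵀ P x`. -/
def normSq : (ι → ℝ) → ℝ := quadForm S.P

/-- The derivative of `normSq` along the dilation. -/
def dilationRate : (ι → ℝ) → ℝ := quadForm (diagonal S.r * S.P + S.P * diagonal S.r)

/-- Minus the derivative of `normSq` along the linear field `M`. -/
def decayRate : (ι → ℝ) → ℝ := quadForm (-(S.Mᵀ * S.P + S.P * S.M))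

lemma r_pos (k : ι) : 0 < S.r k := by
  have h := S.posDef_dilation.diag_pos (i := k)
  simp only [Matrix.add_apply, diagonal_mul, mul_diagonal] at h
  have hP := S.posDef.diag_pos (i := k)
  nlinarith

lemma normSq_pos {x : ι → ℝ} (hx : x ≠ 0) : 0 < S.normSq x := quadForm_pos S.posDef hx

lemma dilationRate_pos {x : ι → ℝ} (hx : x ≠ 0) : 0 < S.dilationRate x :=
  quadForm_pos S.posDef_dilation hx

lemma decayRate_pos {x : ι → ℝ} (hx : x ≠ 0) : 0 < S.decayRate x :=
  quadForm_pos S.posDef_decay hx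

lemma hasDerivAt_normSq {u : ℝ → ι → ℝ} {u' : ι → ℝ} {t a b : ℝ} (hu : HasDerivAt u u' t)
    (hu' : u' = a • S.M *ᵥ u t + b • diagonal S.r *ᵥ u t) :
    HasDerivAt (fun t => S.normSq (u t))
      (b * S.dilationRate (u t) - a * S.decayRate (u t)) t := by
  refine (hasDerivAt_quadForm S.P hu).congr_deriv ?_
  have hdil := quadForm_transpose_mul_add_mul (diagonal S.r) S.P (u t)
  rw [diagonal_transpose] at hdil
  rw [dilationRate, decayRate, quadForm_neg_left, hdil, quadForm_transpose_mul_add_mul, hu']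
  simp only [mulVec_add, mulVec_smul, add_dotProduct, dotProduct_add, smul_dotProduct,
    dotProduct_smul, smul_eq_mul]
  ring

lemma hasDerivAt_normSq_dilation (x : ι → ℝ) (s : ℝ) :
    HasDerivAt (fun s => S.normSq (dilation S.r s x)) (S.dilationRate (dilation S.r s x)) s := by
  have h := S.hasDerivAt_normSq (a := 0) (b := 1)
    (hasDerivAt_dilation (r := S.r) (hasDerivAt_id s) (hasDerivAt_const s x))
    (by simp [diagonal_mulVec_dilation])
  simpa using h

lemma strictMono_normSq_dilation {x : ι → ℝ} (hx : x ≠ 0) :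
    StrictMono fun s => S.normSq (dilation S.r s x) :=
  strictMono_of_hasDerivAt_pos (S.hasDerivAt_normSq_dilation x) fun _ =>
    S.dilationRate_pos (dilation_ne_zero hx)

lemma existsUnique_normSq_dilation_neg {x : ι → ℝ} (hx : x ≠ 0) :
    ∃! s, S.normSq (dilation S.r (-s) x) = 1 := by
  have hcont : Continuous fun s => S.normSq (dilation S.r s x) :=
    (continuous_quadForm S.P).comp (continuous_dilation continuous_id continuous_const)
  obtain ⟨a, ha⟩ : ∃ a, S.normSq (dilation S.r a x) < 1 := by
    have hbot : Tendsto (fun s => dilation S.r s x) atBot (𝓝 0) := tendsto_pi_nhds.2 fun k => by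
      simpa using (Real.tendsto_exp_atBot.comp
        (tendsto_id.atBot_mul_const (S.r_pos k))).mul_const (x k)
    have hq := ((continuous_quadForm S.P).tendsto 0).comp hbot
    rw [quadForm_zero] at hq
    exact (hq.eventually_lt_const one_pos).exists
  obtain ⟨b, hb⟩ : ∃ b, 1 < S.normSq (dilation S.r b x) := by
    obtain ⟨k, hk⟩ := Function.ne_iff.1 hx
    obtain ⟨C, hC, hle⟩ := exists_sq_norm_mulVec_le 1 S.posDef
    have htop : Tendsto (fun s => (Real.exp (s * S.r k) * |x k|) ^ 2) atTop atTop :=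
      (tendsto_pow_atTop two_ne_zero).comp <| (Real.tendsto_exp_atTop.comp
        (tendsto_id.atTop_mul_const (S.r_pos k))).atTop_mul_const (abs_pos.2 hk)
    obtain ⟨b, hb⟩ := (htop.eventually_gt_atTop C).exists
    refine ⟨b, lt_of_mul_lt_mul_left ?_ hC.le⟩
    have hk := norm_le_pi_norm (dilation S.r b x) k
    rw [dilation_apply, norm_mul, Real.norm_eq_abs, Real.norm_eq_abs, Real.abs_exp] at hk
    calc C * 1 < (Real.exp (b * S.r k) * |x k|) ^ 2 := by simpa using hb
      _ ≤ ‖dilation S.r b x‖ ^ 2 := by gcongr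
      _ ≤ C * S.normSq (dilation S.r b x) := by simpa [normSq] using hle (dilation S.r b x)
  obtain ⟨s, hs⟩ := mem_range_of_exists_le_of_exists_ge hcont ⟨a, ha.le⟩ ⟨b, hb.le⟩
  exact ⟨-s, by simpa using hs, fun t ht =>
    neg_eq_iff_eq_neg.1 ((S.strictMono_normSq_dilation hx).injective (ht.trans hs.symm))⟩

/-- The logarithm `s` of the homogeneous norm of `x ≠ 0`, i.e. the `s` for which `dilation (-s) x`
is on the unit sphere. -/
def logNorm (x : ι → ℝ) : ℝ :=
  Classical.epsilon fun s : ℝ => S.normSq (dilation S.r (-s) x) = 1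

/-- The projection of `x ≠ 0` to the unit sphere along its dilation orbit; it maps `0` to `0`. -/
def sphereProj (x : ι → ℝ) : ι → ℝ := dilation S.r (-S.logNorm x) x

variable {x : ι → ℝ}

lemma normSq_sphereProj (hx : x ≠ 0) : S.normSq (S.sphereProj x) = 1 :=
  Classical.epsilon_spec (S.existsUnique_normSq_dilation_neg hx).exists

lemma sphereProj_ne_zero (hx : x ≠ 0) : S.sphereProj x ≠ 0 := dilation_ne_zero hx

@[simp] lemma sphereProj_zero : S.sphereProj 0 = 0 := map_zero _

@[simp] lemma dilation_logNorm_sphereProj (x : ι → ℝ) :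
    dilation S.r (S.logNorm x) (S.sphereProj x) = x := by
  simp [sphereProj, dilation_dilation]

lemma logNorm_eq {s : ℝ} (h : S.normSq (dilation S.r (-s) x) = 1) : S.logNorm x = s := by
  have hx : x ≠ 0 := by
    rintro rfl
    simp [normSq] at h
  exact (S.existsUnique_normSq_dilation_neg hx).unique (S.normSq_sphereProj hx) h

lemma logNorm_dilation (hx : S.normSq x = 1) (s : ℝ) : S.logNorm (dilation S.r s x) = s :=
  S.logNorm_eq (by simpa [dilation_dilation] using hx)

lemma sphereProj_dilation (hx : S.normSq x = 1) (s : ℝ) :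
    S.sphereProj (dilation S.r s x) = x := by
  simp [sphereProj, S.logNorm_dilation hx, dilation_dilation]

lemma logNorm_neg (x : ι → ℝ) : S.logNorm (-x) = S.logNorm x := by
  have hneg : ∀ y, S.normSq (-y) = S.normSq y := fun y => by simp [normSq, quadForm, mulVec_neg]
  simp only [logNorm, map_neg, hneg]

lemma sphereProj_neg (x : ι → ℝ) : S.sphereProj (-x) = -S.sphereProj x := by
  simp only [sphereProj, logNorm_neg, map_neg]

lemma contDiffAt_logNorm (hx : x ≠ 0) : ContDiffAt ℝ 1 S.logNorm x := by
  let f : (ι → ℝ) × ℝ → ℝ := fun z => S.normSq (dilation S.r (-z.2) z.1)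
  let z : (ι → ℝ) × ℝ := (x, S.logNorm x)
  have hf : ContDiff ℝ 1 f :=
    (contDiff_quadForm S.P).comp <| contDiff_iff_contDiffAt.2 fun _ =>
      contDiffAt_dilation contDiffAt_snd.neg contDiffAt_fst
  have hpartial : (fderiv ℝ f z ∘L .inr ℝ (ι → ℝ) ℝ) 1 = -S.dilationRate (S.sphereProj x) := by
    have hchain : HasDerivAt (fun s : ℝ => f (x, s)) (fderiv ℝ f z (0, 1)) (S.logNorm x) :=
      (hf.differentiable one_ne_zero z).hasFDerivAt.comp_hasDerivAt (S.logNorm x)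
        ((hasDerivAt_const _ x).prodMk (hasDerivAt_id _))
    have hrate := (S.hasDerivAt_normSq_dilation x (-S.logNorm x)).scomp (S.logNorm x)
      (hasDerivAt_neg (S.logNorm x))
    simpa [sphereProj] using hchain.unique hrate
  have hinv : (fderiv ℝ f z ∘L .inr ℝ (ι → ℝ) ℝ).IsInvertible := by
    refine ⟨ContinuousLinearEquiv.unitsEquivAut ℝ
      (Units.mk0 _ (neg_ne_zero.2 (S.dilationRate_pos (S.sphereProj_ne_zero hx)).ne')), ?_⟩
    ext
    simp [← hpartial]
  refine (hf.contDiffAt.contDiffAt_implicitFunction one_ne_zero hinv).congr_of_eventuallyEq ?_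
  filter_upwards [hf.contDiffAt.eventually_apply_implicitFunction one_ne_zero hinv] with y hy
  exact S.logNorm_eq (hy.trans (S.normSq_sphereProj hx))

lemma contDiffAt_sphereProj (hx : x ≠ 0) : ContDiffAt ℝ 1 S.sphereProj x :=
  contDiffAt_dilation (S.contDiffAt_logNorm hx).neg contDiffAt_id

open Classical in
/-- The canonical homogeneous norm induced by `√(xᵀ P x)`. -/
def homNorm (x : ι → ℝ) : ℝ := if x = 0 then 0 else Real.exp (S.logNorm x)

@[simp] lemma homNorm_zero : S.homNorm 0 = 0 := if_pos rfl

lemma homNorm_of_ne_zero (hx : x ≠ 0) : S.homNorm x = Real.exp (S.logNorm x) := if_neg hx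

lemma homNorm_pos (hx : x ≠ 0) : 0 < S.homNorm x := by
  rw [S.homNorm_of_ne_zero hx]
  exact Real.exp_pos _

lemma homNorm_nonneg (x : ι → ℝ) : 0 ≤ S.homNorm x := by
  rcases eq_or_ne x 0 with rfl | hx
  · exact S.homNorm_zero.ge
  · exact (S.homNorm_pos hx).le

lemma homNorm_rpow (hx : x ≠ 0) (p : ℝ) : S.homNorm x ^ p = Real.exp (p * S.logNorm x) := by
  rw [S.homNorm_of_ne_zero hx, ← Real.exp_mul, mul_comm]

lemma homNorm_lt_iff {ρ : ℝ} (hρ : 0 < ρ) :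
    S.homNorm x < ρ ↔ S.normSq (dilation S.r (-Real.log ρ) x) < 1 := by
  rcases eq_or_ne x 0 with rfl | hx
  · simp [normSq, hρ]
  · rw [S.homNorm_of_ne_zero hx, ← Real.lt_log_iff_exp_lt hρ, ← S.normSq_sphereProj hx, sphereProj,
      (S.strictMono_normSq_dilation hx).lt_iff_lt, neg_lt_neg_iff]

lemma continuous_homNorm : Continuous S.homNorm := by
  refine continuous_iff_continuousAt.2 fun x => ?_
  rcases eq_or_ne x 0 with rfl | hx
  · rw [ContinuousAt, homNorm_zero]
    refine tendsto_order.2 ⟨fun ρ hρ => .of_forall fun x => hρ.trans_le (S.homNorm_nonneg x),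
      fun ρ hρ => ?_⟩
    simp only [S.homNorm_lt_iff hρ]
    have hcont : Continuous fun x => S.normSq (dilation S.r (-Real.log ρ) x) :=
      (continuous_quadForm S.P).comp (continuous_dilation continuous_const continuous_id)
    exact hcont.continuousAt.eventually_lt_const (by simp [normSq])
  · refine (S.contDiffAt_logNorm hx).continuousAt.rexp.congr ?_
    filter_upwards [isOpen_compl_singleton.mem_nhds hx] with y hy
    exact (S.homNorm_of_ne_zero hy).symm

lemma exists_abs_dilation_mulVec_sphereProj_le (A : Matrix ι ι ℝ) :
    ∃ R, ∀ x, x ≠ 0 → ∀ k,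
      |dilation S.r (S.logNorm x) (A *ᵥ S.sphereProj x) k| ≤ R * S.homNorm x ^ S.r k := by
  obtain ⟨C, -, hle⟩ := exists_sq_norm_mulVec_le A S.posDef
  refine ⟨√C, fun x hx k => ?_⟩
  have hnorm : ‖A *ᵥ S.sphereProj x‖ ≤ √C := Real.le_sqrt_of_sq_le <| by
    have h1 := S.normSq_sphereProj hx
    rw [normSq] at h1
    simpa [h1] using hle (S.sphereProj x)
  rw [dilation_apply, abs_mul, Real.abs_exp, S.homNorm_rpow hx, mul_comm, mul_comm (S.logNorm x)]
  gcongr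
  exact (norm_le_pi_norm (A *ᵥ S.sphereProj x) k).trans hnorm

lemma comap_homNorm_le : comap S.homNorm (𝓝 0) ≤ 𝓝 0 := by
  obtain ⟨R, hR⟩ := S.exists_abs_dilation_mulVec_sphereProj_le 1
  refine tendsto_id'.1 (tendsto_pi_nhds.2 fun k => squeeze_zero_norm (fun x => ?_)
    (a := fun x => R * S.homNorm x ^ S.r k) ?_)
  · rcases eq_or_ne x 0 with rfl | hx
    · simp [(S.r_pos k).ne']
    · have hle := hR x hx k
      rwa [one_mulVec, dilation_logNorm_sphereProj] at hle
  · have hlim : Tendsto S.homNorm (comap S.homNorm (𝓝 0)) (𝓝 0) := tendsto_comap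
    simpa [(S.r_pos k).ne'] using (hlim.rpow_const (.inr (S.r_pos k).le)).const_mul R

/-- The field which is homogeneous of degree `μ` and equals `x ↦ M x` on the unit sphere. -/
def field (x : ι → ℝ) : ι → ℝ :=
  Real.exp (S.μ * S.logNorm x) • dilation S.r (S.logNorm x) (S.M *ᵥ S.sphereProj x)

@[simp] lemma field_zero : S.field 0 = 0 := by simp [field]

lemma field_neg (x : ι → ℝ) : S.field (-x) = -S.field x := by
  simp [field, logNorm_neg, sphereProj_neg, mulVec_neg]

lemma field_dilation (hx : S.normSq x = 1) (s : ℝ) :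
    S.field (dilation S.r s x) = Real.exp (S.μ * s) • dilation S.r s (S.M *ᵥ x) := by
  rw [field, S.logNorm_dilation hx, S.sphereProj_dilation hx]

lemma contDiffAt_field (hx : x ≠ 0) : ContDiffAt ℝ 1 S.field x := by
  have hL := S.contDiffAt_logNorm hx
  have hM : ContDiffAt ℝ 1 (fun x => S.M *ᵥ S.sphereProj x) x :=
    (contDiff_mulVec S.M).contDiffAt.comp x (S.contDiffAt_sphereProj hx)
  exact (contDiffAt_const.mul hL).exp.smul (contDiffAt_dilation hL hM)

lemma exists_abs_field_le :
    ∃ R, ∀ x, x ≠ 0 → ∀ k, |S.field x k| ≤ R * S.homNorm x ^ (S.μ + S.r k) := by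
  obtain ⟨R, hR⟩ := S.exists_abs_dilation_mulVec_sphereProj_le S.M
  refine ⟨R, fun x hx k => ?_⟩
  rw [field, Pi.smul_apply, smul_eq_mul, abs_mul, Real.abs_exp,
    Real.rpow_add (S.homNorm_pos hx), S.homNorm_rpow hx S.μ, mul_left_comm]
  gcongr
  exact hR x hx k

lemma continuous_field (h : ∀ k, 0 < S.μ + S.r k) : Continuous S.field := by
  refine continuous_iff_continuousAt.2 fun x => ?_
  rcases eq_or_ne x 0 with rfl | hx
  · obtain ⟨R, hR⟩ := S.exists_abs_field_le
    rw [ContinuousAt, field_zero]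
    refine tendsto_pi_nhds.2 fun k => squeeze_zero_norm (fun x => ?_)
      (a := fun x => R * S.homNorm x ^ (S.μ + S.r k)) ?_
    · rcases eq_or_ne x 0 with rfl | hx
      · simp [(h k).ne']
      · exact hR x hx k
    · simpa [(h k).ne'] using
        ((S.continuous_homNorm.tendsto 0).rpow_const (.inr (h k).le)).const_mul R
  · exact (S.contDiffAt_field hx).continuousAt

lemma exists_norm_field_le (h : ∀ k, 0 ≤ S.μ + S.r k) (ρ : ℝ) :
    ∃ C, ∀ x, S.homNorm x ≤ ρ → ‖S.field x‖ ≤ C := by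
  obtain ⟨R, hR⟩ := S.exists_abs_field_le
  refine ⟨‖fun k => |R| * ρ ^ (S.μ + S.r k)‖, fun x hx => ?_⟩
  rcases eq_or_ne x 0 with rfl | hne
  · simp
  refine (pi_norm_le_iff_of_nonneg (norm_nonneg _)).2 fun k => ?_
  calc ‖S.field x k‖ ≤ R * S.homNorm x ^ (S.μ + S.r k) := hR x hne k
    _ ≤ |R| * ρ ^ (S.μ + S.r k) := by
      have hnn := S.homNorm_nonneg x
      gcongr
      exacts [le_abs_self R, h k]
    _ ≤ _ := (le_abs_self _).trans (norm_le_pi_norm (fun k => |R| * ρ ^ (S.μ + S.r k)) k)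

/-- The rate at which the homogeneous norm `ρ` decreases along solutions:
`ρ' = -contractionRate * ρ ^ (1 + μ)`. -/
def contractionRate (x : ι → ℝ) : ℝ :=
  S.decayRate (S.sphereProj x) / S.dilationRate (S.sphereProj x)

lemma exists_le_contractionRate : ∃ c > 0, ∀ x, x ≠ 0 → c ≤ S.contractionRate x := by
  obtain ⟨C, hC, hle⟩ := exists_quadForm_le _ S.posDef_decay
  refine ⟨C⁻¹, inv_pos.2 hC, fun x hx => ?_⟩
  rw [contractionRate, le_div_iff₀ (S.dilationRate_pos (S.sphereProj_ne_zero hx)),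
    inv_mul_le_iff₀ hC]
  exact hle _

lemma hasDerivAt_homNorm_comp {y : ℝ → ι → ℝ} {t : ℝ} (hy : HasDerivAt y (S.field (y t)) t)
    (hne : y t ≠ 0) :
    HasDerivAt (fun s => S.homNorm (y s))
      (-(S.contractionRate (y t) * S.homNorm (y t) ^ (1 + S.μ))) t := by
  obtain ⟨L', hL⟩ : ∃ L', HasDerivAt (fun s => S.logNorm (y s)) L' t :=
    ⟨_, ((S.contDiffAt_logNorm hne).differentiableAt one_ne_zero).hasFDerivAt.comp_hasDerivAt t hy⟩
  have hev : ∀ᶠ s in 𝓝 t, y s ≠ 0 := hy.continuousAt.eventually_ne hne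
  -- `normSq` is constantly `1` along the projection of `y` to the sphere, which determines `L'`.
  have hconst : HasDerivAt (fun s => S.normSq (S.sphereProj (y s))) 0 t := by
    refine (hasDerivAt_const t 1).congr_of_eventuallyEq ?_
    filter_upwards [hev] with s hs using S.normSq_sphereProj hs
  have hrate := hconst.unique <| S.hasDerivAt_normSq (a := Real.exp (S.μ * S.logNorm (y t)))
    (b := -L') (hasDerivAt_dilation hL.neg hy) (by
      rw [map_add, map_smul, ← diagonal_mulVec_dilation, field, map_smul, dilation_dilation,
        neg_add_cancel, dilation_zero_left, add_comm]
      rfl)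
  have hL' : L' = -(S.contractionRate (y t) * Real.exp (S.μ * S.logNorm (y t))) := by
    have hpos := S.dilationRate_pos (S.sphereProj_ne_zero hne)
    change 0 = -L' * S.dilationRate (S.sphereProj (y t)) - _ * S.decayRate (S.sphereProj (y t))
      at hrate
    rw [contractionRate]
    field_simp
    linarith
  have hexp := hL.exp.congr_of_eventuallyEq (hev.mono fun s hs => S.homNorm_of_ne_zero hs)
  refine hexp.congr_deriv ?_
  rw [hL', S.homNorm_rpow hne, add_mul, one_mul, Real.exp_add]
  ring

section Dynamics

variable {y : ℝ → ι → ℝ}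

lemma homNorm_le_of_isSolutionOffZeroOn {a b : ℝ} (hab : a ≤ b)
    (hy : IsSolutionOffZeroOn S.field y (Icc a b)) : S.homNorm (y b) ≤ S.homNorm (y a) := by
  refine image_le_of_deriv_nonpos_of_lt (f := fun t => S.homNorm (y t)) hab
    (S.continuous_homNorm.comp_continuousOn hy.continuousOn) fun t ht hlt => ?_
  have hne : y t ≠ 0 := fun h => by
    rw [h, homNorm_zero] at hlt
    exact hlt.not_ge (S.homNorm_nonneg _)
  have hd := S.hasDerivAt_homNorm_comp (hy.hasDerivAt (Icc_mem_nhds ht.1 ht.2) hne) hne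
  refine ⟨hd.differentiableAt, hd.deriv.trans_le (neg_nonpos.2 ?_)⟩
  have hrate : 0 < S.contractionRate (y t) := div_pos
    (S.decayRate_pos (S.sphereProj_ne_zero hne)) (S.dilationRate_pos (S.sphereProj_ne_zero hne))
  exact mul_nonneg hrate.le (Real.rpow_nonneg (S.homNorm_nonneg _) _)

lemma staysAtZeroOn {J : Set ℝ} (hy : IsSolutionOffZeroOn S.field y J) (hJ : J.OrdConnected) :
    StaysAtZeroOn y J := by
  intro s hs t ht hst hys
  have hle := S.homNorm_le_of_isSolutionOffZeroOn hst (hy.mono (hJ.out hs ht))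
  rw [hys, homNorm_zero] at hle
  by_contra hne
  exact hle.not_gt (S.homNorm_pos hne)

theorem eqOn_of_isSolutionOffZeroOn {z : ℝ → ι → ℝ} {a b : ℝ}
    (hy : IsSolutionOffZeroOn S.field y (Icc a b)) (hz : IsSolutionOffZeroOn S.field z (Icc a b))
    (ha : y a = z a) : EqOn y z (Icc a b) :=
  IsSolutionOffZeroOn.eqOn (fun _ => S.contDiffAt_field) hy hz
    (S.staysAtZeroOn hy ordConnected_Icc) (S.staysAtZeroOn hz ordConnected_Icc) ha

theorem exists_forall_norm_lt {ε : ℝ} (hε : 0 < ε) : ∃ δ > 0, ∀ y : ℝ → ι → ℝ,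
    ∀ t, 0 ≤ t → IsSolutionOffZeroOn S.field y (Icc 0 t) → ‖y 0‖ < δ → ‖y t‖ < ε := by
  obtain ⟨ρ, hρ, hsub⟩ := (Metric.nhds_basis_ball.comap S.homNorm).mem_iff.1
    (S.comap_homNorm_le (Metric.ball_mem_nhds 0 hε))
  obtain ⟨δ, hδ, hlt⟩ := Metric.eventually_nhds_iff_ball.1
    ((S.continuous_homNorm.tendsto 0).eventually_lt_const (S.homNorm_zero.trans_lt hρ))
  refine ⟨δ, hδ, fun y t ht hy hy0 => mem_ball_zero_iff.1 (hsub ?_)⟩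
  rw [mem_preimage, mem_ball_zero_iff, Real.norm_of_nonneg (S.homNorm_nonneg _)]
  exact (S.homNorm_le_of_isSolutionOffZeroOn ht hy).trans_lt (hlt _ (mem_ball_zero_iff.2 hy0))

theorem exists_settlingTime (hμ : S.μ < 0) : ∃ T : (ι → ℝ) → ℝ, ∀ y : ℝ → ι → ℝ,
    ∀ t, IsSolutionOffZeroOn S.field y (Icc 0 t) → T (y 0) ≤ t → y t = 0 := by
  obtain ⟨c, hc, hle⟩ := S.exists_le_contractionRate
  have hμc : 0 < -S.μ * c := mul_pos (neg_pos.2 hμ) hc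
  refine ⟨fun x => S.homNorm x ^ (-S.μ) / (-S.μ * c), fun y t hy ht => ?_⟩
  rw [div_le_iff₀ hμc] at ht
  have ht0 : 0 ≤ t := nonneg_of_mul_nonneg_left
    ((Real.rpow_nonneg (S.homNorm_nonneg _) _).trans ht) hμc
  by_contra hne
  have hne' : ∀ s ∈ Icc 0 t, y s ≠ 0 := fun s hs h =>
    hne (S.staysAtZeroOn hy ordConnected_Icc s hs t (right_mem_Icc.2 ht0) hs.2 h)
  have hmono : S.homNorm (y t) ^ (-S.μ) + -S.μ * c * t ≤
      S.homNorm (y 0) ^ (-S.μ) + -S.μ * c * 0 := by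
    refine image_le_of_deriv_nonpos_of_lt (f := fun s => S.homNorm (y s) ^ (-S.μ) + -S.μ * c * s)
      ht0 ?_ fun s hs _ => ?_
    · have hcont : ContinuousOn (fun s => S.homNorm (y s)) (Icc 0 t) :=
        S.continuous_homNorm.comp_continuousOn hy.continuousOn
      exact (hcont.rpow_const fun s _ => .inr (neg_pos.2 hμ).le).add (by fun_prop)
    · have hs0 := hne' s (Ioo_subset_Icc_self hs)
      have hpos := S.homNorm_pos hs0
      have hnorm := S.hasDerivAt_homNorm_comp (hy.hasDerivAt (Icc_mem_nhds hs.1 hs.2) hs0) hs0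
      have hd := (hnorm.rpow_const (p := -S.μ) (.inl hpos.ne')).add
        ((hasDerivAt_id s).const_mul (-S.μ * c))
      refine ⟨hd.differentiableAt, hd.deriv.trans_le ?_⟩
      have hpow : S.homNorm (y s) ^ (1 + S.μ) * S.homNorm (y s) ^ (-S.μ - 1) = 1 := by
        rw [← Real.rpow_add hpos, show 1 + S.μ + (-S.μ - 1) = 0 by ring, Real.rpow_zero]
      calc _ = S.μ * (S.contractionRate (y s) *
            (S.homNorm (y s) ^ (1 + S.μ) * S.homNorm (y s) ^ (-S.μ - 1)) - c) := by ring
        _ ≤ 0 := by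
          rw [hpow, mul_one]
          exact mul_nonpos_of_nonpos_of_nonneg hμ.le (sub_nonneg.2 (hle _ hs0))
  have hpos := Real.rpow_pos_of_pos (S.homNorm_pos hne) (-S.μ)
  linarith

end Dynamics

section Existence

-- In the time `τ` with `dt/dτ = exp (-μ s) * dilationRate π`, a solution `dilation s π` with `π` on
-- the unit sphere satisfies `π' = dilationRate π • M π + decayRate π • diag r π`, which does not
-- involve `s`, and `s' = -decayRate π`.
lemma exists_angular_curve {x : ι → ℝ} (hx : S.normSq x = 1) : ∃ π : ℝ → ι → ℝ, π 0 = x ∧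
    (∀ t, S.normSq (π t) = 1) ∧ ∀ t, HasDerivAt π
      (S.dilationRate (π t) • S.M *ᵥ π t + S.decayRate (π t) • diagonal S.r *ᵥ π t) t := by
  obtain ⟨C, hC, hle⟩ := exists_sq_norm_mulVec_le 1 S.posDef
  -- A cutoff that equals `1` on the unit sphere of `normSq` makes the field globally Lipschitz.
  let φ : ContDiffBump (0 : ι → ℝ) := ⟨C + 1, C + 2, by linarith, by linarith⟩
  let v : (ι → ℝ) → ι → ℝ := fun x =>
    (φ x * S.dilationRate x) • S.M *ᵥ x + (φ x * S.decayRate x) • diagonal S.r *ᵥ x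
  have hφ := φ.contDiff (n := 1)
  have hv : ContDiff ℝ 1 v :=
    ((hφ.mul (contDiff_quadForm _)).smul (contDiff_mulVec S.M)).add
      ((hφ.mul (contDiff_quadForm _)).smul (contDiff_mulVec _))
  have hsupp : HasCompactSupport v :=
    φ.hasCompactSupport.mul_right.smul_right.add φ.hasCompactSupport.mul_right.smul_right
  obtain ⟨K, hK⟩ := hv.lipschitzWith_of_hasCompactSupport hsupp one_ne_zero
  obtain ⟨B, hB⟩ := hv.continuous.bounded_above_of_compact_support hsupp
  obtain ⟨π, hπ0, hπ⟩ := exists_isIntegralCurve_of_lipschitzWith (C := B.toNNReal) hK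
    (fun x => (hB x).trans (Real.le_coe_toNNReal B)) x
  have hconst : ∀ t, HasDerivAt (fun t => S.normSq (π t)) 0 t := fun t =>
    (S.hasDerivAt_normSq (hπ t) rfl).congr_deriv (by ring)
  have hone : ∀ t, S.normSq (π t) = 1 := fun t => by
    rw [is_const_of_deriv_eq_zero (f := fun t => S.normSq (π t))
      (fun t => (hconst t).differentiableAt) (fun t => (hconst t).deriv) t 0, hπ0, hx]
  refine ⟨π, hπ0, hone, fun t => (hπ t).congr_deriv ?_⟩
  have hφ1 : φ (π t) = 1 := φ.one_of_mem_closedBall <| mem_closedBall_zero_iff.2 <| by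
    have hsq := hle (π t)
    rw [one_mulVec, ← normSq, hone t] at hsq
    change ‖π t‖ ≤ C + 1
    nlinarith
  simp only [v, hφ1, one_mul]

lemma exists_radial_function {π : ℝ → ι → ℝ} (hπ : Continuous π)
    (hone : ∀ t, S.normSq (π t) = 1) (s₀ : ℝ) : ∃ s : ℝ → ℝ, s 0 = s₀ ∧
      (∀ t, HasDerivAt s (-S.decayRate (π t)) t) ∧ Tendsto s atTop atBot := by
  obtain ⟨C, hC, hle⟩ := exists_quadForm_le S.P S.posDef_decay
  have hcont : Continuous fun t => S.decayRate (π t) := (continuous_quadForm _).comp hπ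
  let s : ℝ → ℝ := fun t => s₀ - ∫ u in (0 : ℝ)..t, S.decayRate (π u)
  have hs : ∀ t, HasDerivAt s (-S.decayRate (π t)) t := fun t =>
    (hcont.integral_hasStrictDerivAt 0 t).hasDerivAt.const_sub _
  refine ⟨s, by simp [s], hs, ?_⟩
  have hrate : ∀ t, deriv s t ≤ -C⁻¹ := fun t => by
    have hCm : 1 ≤ C * S.decayRate (π t) := hone t ▸ hle (π t)
    rw [(hs t).deriv, neg_le_neg_iff]
    exact (inv_le_iff_one_le_mul₀' hC).2 hCm
  refine tendsto_atBot_mono' atTop ?_ (tendsto_atBot_add_const_left _ (s 0)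
    (tendsto_id.const_mul_atTop_of_neg (neg_neg_of_pos (inv_pos.2 hC))))
  filter_upwards [eventually_ge_atTop 0] with t ht
  have hle := image_sub_le_mul_sub_of_deriv_le (fun t => (hs t).differentiableAt) hrate ht
  rw [sub_zero] at hle
  exact sub_le_iff_le_add'.1 hle

theorem exists_isSolutionOffZeroOn (x : ι → ℝ) :
    ∃ y, y 0 = x ∧ IsSolutionOffZeroOn S.field y (Ici 0) := by
  rcases eq_or_ne x 0 with rfl | hx
  · exact ⟨fun _ => 0, rfl, continuousOn_const, fun _ _ hne => absurd rfl hne⟩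
  obtain ⟨π, hπ0, hone, hπ⟩ := S.exists_angular_curve (S.normSq_sphereProj hx)
  have hπc : Continuous π := continuous_iff_continuousAt.2 fun t => (hπ t).continuousAt
  obtain ⟨s, hs0, hs, hslim⟩ := S.exists_radial_function hπc hone (S.logNorm x)
  have hne : ∀ t, π t ≠ 0 := fun t h => by simpa [h, normSq] using hone t
  let w : ℝ → ℝ := fun t => Real.exp (-(S.μ * s t)) * S.dilationRate (π t)
  let γ : ℝ → ι → ℝ := fun t => dilation S.r (s t) (π t)
  have hw : Continuous w := by
    have hsc : Continuous s := continuous_iff_continuousAt.2 fun t => (hs t).continuousAt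
    exact (hsc.const_mul S.μ).neg.rexp.mul ((continuous_quadForm _).comp hπc)
  have hγ : ∀ t, HasDerivAt γ (w t • S.field (γ t)) t := fun t => by
    refine (hasDerivAt_dilation (hs t) (hπ t)).congr_deriv ?_
    rw [S.field_dilation (hone t), smul_smul, mul_right_comm, ← Real.exp_add, neg_add_cancel,
      Real.exp_zero, one_mul, ← map_smul, neg_smul, neg_add_eq_sub, add_sub_cancel_right]
  have hγlim : Tendsto γ atTop (𝓝 0) := by
    refine (tendsto_comap_iff.2 ?_).mono_right S.comap_homNorm_le
    refine (Real.tendsto_exp_atBot.comp hslim).congr fun t => ?_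
    rw [Function.comp, Function.comp, S.homNorm_of_ne_zero (dilation_ne_zero (hne t)),
      S.logNorm_dilation (hone t)]
  obtain ⟨y, hy0, hy⟩ := exists_isSolutionOffZeroOn_of_time_change hw
    (fun t => mul_pos (Real.exp_pos _) (S.dilationRate_pos (hne t))) hγ hγlim
  exact ⟨y, by simp [hy0, γ, hs0, hπ0], hy⟩

end Existence

section Product

variable (κ : Type*) [Fintype κ]

/-- The field of independent copies of the system, one for each element of `κ`. -/
def prodField (e : κ → ι → ℝ) : κ → ι → ℝ := fun i => S.field (e i)

variable {κ}

lemma apply_eq_field_of_mem_filippov {e w : κ → ι → ℝ} (hw : w ∈ filippov (S.prodField κ) e)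
    {i : κ} (hi : e i ≠ 0) : w i = S.field (e i) :=
  apply_eq_of_mem_filippov hw (ContinuousLinearMap.proj (R := ℝ) (φ := fun _ => ι → ℝ) i)
    ((S.contDiffAt_field hi).continuousAt.comp (f := fun z : κ → ι → ℝ => z i)
      (continuous_apply i).continuousAt)

-- The field is odd, so reflecting the components that vanish in `e` cancels their jump.
lemma prodField_mem_filippov (e : κ → ι → ℝ) :
    S.prodField κ e ∈ filippov (S.prodField κ) e := by
  classical
  let φ : (κ → ι → ℝ) → κ → ι → ℝ := fun z i => if e i = 0 then -z i else z i
  have hφ : MeasurePreserving φ volume volume := by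
    refine volume_preserving_pi (f := fun i (v : ι → ℝ) => if e i = 0 then -v else v) fun i => ?_
    split_ifs
    · exact Measure.measurePreserving_neg volume
    · exact MeasurePreserving.id volume
  have hφe : Tendsto φ (𝓝 e) (𝓝 e) := by
    refine tendsto_pi_nhds.2 fun i => ?_
    have hi : Tendsto (fun z : κ → ι → ℝ => z i) (𝓝 e) (𝓝 (e i)) :=
      (continuous_apply i).continuousAt
    by_cases h : e i = 0
    · simpa [φ, h] using hi.neg
    · simpa [φ, h] using hi
  refine mem_filippov_of_tendsto_midpoint hφ.quasiMeasurePreserving hφe ?_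
  refine tendsto_pi_nhds.2 fun i => ?_
  by_cases h : e i = 0
  · refine tendsto_const_nhds.congr fun z => ?_
    simp [midpoint_eq_smul_add, prodField, φ, h, field_neg]
  · refine Tendsto.congr (f₁ := fun z : κ → ι → ℝ => S.field (z i)) (fun z => ?_)
      ((S.contDiffAt_field h).continuousAt.tendsto.comp (continuous_apply i).continuousAt)
    simp [prodField, φ, h]

variable {S} in
lemma isSolutionOffZeroOn_apply {y : ℝ → κ → ι → ℝ} {J : Set ℝ}
    (hy : IsSolutionOn S.μ (S.prodField κ) y J) {b : ℝ} (hb : 0 ≤ b) (hJ : Icc 0 b ⊆ J) (i : κ) :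
    IsSolutionOffZeroOn S.field (fun t => y t i) (Icc 0 b) := by
  by_cases hμ : S.μ = -1
  · obtain ⟨hac, hd⟩ := hy.2 hμ
    have haci : AbsolutelyContinuousOnInterval (fun t => y t i) 0 b :=
      squeeze_zero (fun _ => Finset.sum_nonneg fun _ _ => dist_nonneg)
        (fun _ => Finset.sum_le_sum fun _ _ => dist_le_pi_dist _ _ i) (hac 0 b hb hJ)
    refine .of_ae_hasDerivAt hb (fun x hx => (S.contDiffAt_field hx).continuousAt) haci ?_
    filter_upwards [hd] with t ht htb hne
    obtain ⟨w, hw, hyw⟩ := ht (hJ htb)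
    rw [← S.apply_eq_field_of_mem_filippov hw hne]
    exact hasDerivAt_pi.1 hyw i
  · have hd : ∀ t ∈ Icc 0 b, HasDerivWithinAt (fun t => y t i) (S.field (y t i)) (Icc 0 b) t :=
      fun t ht => (hasDerivWithinAt_pi.1 (hy.1 hμ t (hJ ht)) i).mono hJ
    exact ⟨fun t ht => (hd t ht).continuousWithinAt, fun t ht _ => hd t ht⟩

lemma exists_absolutelyContinuous_solution (h : ∀ k, 0 ≤ S.μ + S.r k) (y₀ : κ → ι → ℝ) :
    ∃ y : ℝ → κ → ι → ℝ, y 0 = y₀ ∧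
      (∀ a b, a ≤ b → Icc a b ⊆ Ici 0 → AbsolutelyContinuousOnInterval y a b) ∧
      ∀ᵐ t : ℝ, t ∈ Ici 0 → HasDerivAt y (S.prodField κ (y t)) t := by
  choose y hy0 hy using fun i => S.exists_isSolutionOffZeroOn (y₀ i)
  have hzero := fun i => S.staysAtZeroOn (hy i) ordConnected_Ici
  choose C hC using fun i => S.exists_norm_field_le h (S.homNorm (y i 0))
  refine ⟨fun t i => y i t, funext hy0, fun a b hab hJ => ?_, ?_⟩
  · refine absolutelyContinuousOnInterval_of_norm_deriv_right_le (C := ‖C‖)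
      (y' := fun t => S.prodField κ fun i => y i t) hab
      (continuousOn_pi.2 fun i => (hy i).continuousOn.mono hJ)
      (fun t ht => hasDerivWithinAt_pi.2 fun i => (hy i).hasDerivWithinAt_Ici (hzero i)
        S.field_zero (hJ ht) (mem_of_superset self_mem_nhdsWithin (Ici_subset_Ici.2 (hJ ht))))
      fun t ht => (pi_norm_le_iff_of_nonneg (norm_nonneg C)).2 fun i => ?_
    have hle := S.homNorm_le_of_isSolutionOffZeroOn (hJ ht) ((hy i).mono Icc_subset_Ici_self)
    exact (hC i _ hle).trans ((le_abs_self _).trans (norm_le_pi_norm C i))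
  · filter_upwards [ae_all_iff.2 fun i => (hy i).ae_hasDerivAt (hzero i) S.field_zero] with t ht h0
    exact hasDerivAt_pi.2 fun i => ht i h0

theorem wellPosed (h : ∀ k, 0 ≤ S.μ + S.r k) (h' : S.μ ≠ -1 → ∀ k, 0 < S.μ + S.r k) :
    WellPosed S.μ (S.prodField κ) := by
  intro y₀
  obtain ⟨y, hy0, hac, hd⟩ := S.exists_absolutelyContinuous_solution h y₀
  have hy : IsSolutionOn S.μ (S.prodField κ) y (Ici 0) := by
    refine ⟨fun hμ t ht => ?_, fun _ => ⟨hac, hd.mono fun t ht h0 =>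
      ⟨_, S.prodField_mem_filippov _, ht h0⟩⟩⟩
    have ht1 : (0 : ℝ) ≤ t + 1 := by linarith [mem_Ici.1 ht]
    have hac1 := hac 0 (t + 1) ht1 Icc_subset_Ici_self
    have hcont : ContinuousOn y (Icc 0 (t + 1)) := by
      simpa [uIcc_of_le ht1] using hac1.continuousOn
    have hfield : Continuous (S.prodField κ) := continuous_pi fun i =>
      (S.continuous_field (h' hμ)).comp (continuous_apply i)
    refine (hasDerivWithinAt_of_ae_hasDerivAt ht1 hac1 (hfield.comp_continuousOn hcont)
      (hd.mono fun s hs hmem => hs hmem.1) ⟨ht, by linarith⟩).mono_of_mem_nhdsWithin ?_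
    filter_upwards [self_mem_nhdsWithin, mem_nhdsWithin_of_mem_nhds (Iic_mem_nhds (lt_add_one t))]
      with s hs hst using ⟨hs, hst⟩
  refine ⟨y, hy0, hy, fun T z _ hz0 hz t ht => funext fun i => ?_⟩
  exact S.eqOn_of_isSolutionOffZeroOn
    (isSolutionOffZeroOn_apply hz ht.1 (Icc_subset_Ico_right ht.2) i)
    (isSolutionOffZeroOn_apply hy ht.1 Icc_subset_Ici_self i) (by rw [hz0, hy0])
    (right_mem_Icc.2 ht.1)

theorem globallyFiniteTimeStable (hμ : S.μ < 0) :
    GloballyFiniteTimeStable S.μ (S.prodField κ) := by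
  refine ⟨fun ε hε => ?_, ?_⟩
  · obtain ⟨δ, hδ, hlt⟩ := S.exists_forall_norm_lt hε
    exact ⟨δ, hδ, fun y hy hy0 t ht => (pi_norm_lt_iff hε).2 fun i => hlt (fun t => y t i) t ht
      (isSolutionOffZeroOn_apply hy ht Icc_subset_Ici_self i)
      ((norm_le_pi_norm (y 0) i).trans_lt hy0)⟩
  · obtain ⟨T, hT⟩ := S.exists_settlingTime hμ
    refine ⟨fun e => 1 + ∑ i, |T (e i)|, fun e => by positivity,
      fun y hy t ht => funext fun i => ?_⟩
    have hle : |T (y 0 i)| ≤ ∑ i, |T (y 0 i)| :=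
      Finset.single_le_sum (f := fun i => |T (y 0 i)|) (fun _ _ => abs_nonneg _)
        (Finset.mem_univ i)
    have hTt : |T (y 0 i)| ≤ t := hle.trans ((le_add_of_nonneg_left zero_le_one).trans ht)
    exact hT (fun t => y t i) t
      (isSolutionOffZeroOn_apply hy ((abs_nonneg _).trans hTt) Icc_subset_Ici_self i)
      ((le_abs_self _).trans hTt)

end Product

end HomogeneousSystem

section Graph

variable {V : Type*} {G : Digraph V} {r : V}

lemma weight_nonneg (G : Digraph V) (i j : V) : 0 ≤ weight G i j := by
  unfold weight
  split_ifs <;> norm_num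

lemma weight_pos_of_adj {i j : V} (h : G.Adj i j) :
    0 < weight G i j := by
  rw [weight, if_pos h]
  exact one_pos

variable [Fintype V]

lemma sum_weight_pos (hroot : IsRoot G r) {i : V} (hi : i ≠ r) : 0 < ∑ j, weight G i j := by
  obtain ⟨j, -, hj⟩ := Relation.TransGen.tail'_iff.1 (hroot.1 i hi)
  exact Finset.sum_pos' (fun j _ => weight_nonneg G i j)
    ⟨j, Finset.mem_univ j, weight_pos_of_adj hj⟩

lemma le_apply_root_of_subharmonic (hroot : IsRoot G r) {d : V → ℝ}
    (h : ∀ i, i ≠ r → ∑ j, weight G i j * (d i - d j) ≤ 0) (i : V) : d i ≤ d r := by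
  have : Nonempty V := ⟨r⟩
  obtain ⟨m, hm⟩ := Finite.exists_max d
  have hstep : ∀ a b, G.Adj b a → b ≠ r → d b = d m → d a = d m := by
    intro a b hba hbr hb
    have hle : ∀ j, 0 ≤ weight G b j * (d b - d j) := fun j =>
      mul_nonneg (weight_nonneg G b j) (sub_nonneg.2 (hb ▸ hm j))
    have hzero := (Finset.single_le_sum (fun j _ => hle j) (Finset.mem_univ a)).trans (h b hbr)
    exact (hm a).antisymm
      (hb ▸ sub_nonpos.1 (nonpos_of_mul_nonpos_right hzero (weight_pos_of_adj hba)))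
  have hroot_max : ∀ b, Relation.ReflTransGen (fun a b => G.Adj b a) r b → d b = d m →
      d r = d m := by
    intro b hb
    induction hb with
    | refl => exact id
    | @tail a b _ hba ih =>
      rcases eq_or_ne b r with rfl | hbr
      · exact id
      · exact fun hb => ih (hstep a b hba hbr hb)
  rcases eq_or_ne m r with rfl | hmr
  · exact hm i
  · exact (hm i).trans_eq (hroot_max m (hroot.1 m hmr).to_reflTransGen rfl).symm

lemma eq_apply_root_of_harmonic (hroot : IsRoot G r) {d : V → ℝ}
    (h : ∀ i, i ≠ r → ∑ j, weight G i j * (d i - d j) = 0) (i : V) : d i = d r := by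
  refine (le_apply_root_of_subharmonic hroot (fun i hi => (h i hi).le) i).antisymm
    (neg_le_neg_iff.1 (le_apply_root_of_subharmonic hroot (d := fun i => -d i) (fun i hi => ?_) i))
  refine (Eq.trans ?_ (neg_eq_zero.2 (h i hi))).le
  rw [← Finset.sum_neg_distrib]
  exact Finset.sum_congr rfl fun j _ => by ring

lemma eq_weighted_average_iff {E : Type*} [AddCommGroup E] [Module ℝ E] {w : V → ℝ}
    (hw : ∑ j, w j ≠ 0) (a b : E) (x v : V → E) :
    b = (1 / ∑ j, w j) • ∑ j, w j • (a - x j + v j) ↔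
      ∑ j, w j • ((b - a) - (v j - x j)) = 0 := by
  rw [one_div, eq_inv_smul_iff₀ hw, ← sub_eq_zero, Finset.sum_smul, ← Finset.sum_sub_distrib]
  simp only [← smul_sub]
  refine Eq.congr_left (Finset.sum_congr rfl fun j _ => congrArg _ ?_)
  abel

end Graph

section Protocol

variable {n N : ℕ} {G : Digraph (Fin (N + 1))}

theorem transmittedEq_iff (hroot : IsRoot G 0) (x v : Fin (N + 1) → Fin n → ℝ) :
    TransmittedEq G x v ↔ ∀ i, v i = x i - x 0 := by
  have hharm : ∀ i : Fin N, _ ↔ _ := fun i => eq_weighted_average_iff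
    (sum_weight_pos hroot (Fin.succ_ne_zero i)).ne' (x i.succ) (v i.succ) x v
  simp only [TransmittedEq, hharm]
  constructor
  · rintro ⟨hv0, hv⟩ i
    ext k
    have hk := eq_apply_root_of_harmonic hroot (d := fun i => v i k - x i k) (fun i hi => by
      obtain ⟨i, rfl⟩ := Fin.exists_succ_eq.2 hi
      simpa using congrFun (hv i) k) i
    simp only [hv0, Pi.zero_apply] at hk
    rw [Pi.sub_apply]
    linarith
  · intro hv
    simp [hv]

lemma existsUnique_fin_cons {α : Type*} (a : α) (f : Fin N → α) :
    ∃! u : Fin (N + 1) → α, u 0 = a ∧ ∀ i : Fin N, u i.succ = f i :=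
  ⟨Fin.cons a f, ⟨rfl, fun _ => rfl⟩, fun _ hu => funext (Fin.cases hu.1 hu.2)⟩

theorem existsUnique_transmittedEq_protocolEq (hroot : IsRoot G 0) (μ : ℝ)
    (K : Matrix (Fin 1) (Fin n) ℝ) (P : Matrix (Fin n) (Fin n) ℝ) (x : Fin (N + 1) → Fin n → ℝ) :
    ∃! p : (Fin (N + 1) → Fin n → ℝ) × (Fin (N + 1) → ℝ),
      TransmittedEq G x p.1 ∧ ProtocolEq μ K P p.1 p.2 := by
  obtain ⟨u, hu, huniq⟩ : ∃! u, ProtocolEq μ K P (fun i => x i - x 0) u := existsUnique_fin_cons 0 _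
  refine ⟨(fun i => x i - x 0, u), ⟨(transmittedEq_iff hroot _ _).2 fun _ => rfl, hu⟩, ?_⟩
  rintro ⟨v, u'⟩ ⟨hv, hu'⟩
  obtain rfl : v = fun i => x i - x 0 := funext ((transmittedEq_iff hroot _ _).1 hv)
  rw [huniq u' hu']

theorem agentField_sub_eq_errorField {μ : ℝ} {K : Matrix (Fin 1) (Fin n) ℝ}
    {P : Matrix (Fin n) (Fin n) ℝ} (hroot : IsRoot G 0) {x v : Fin (N + 1) → Fin n → ℝ}
    {u : Fin (N + 1) → ℝ} (hv : TransmittedEq G x v) (hu : ProtocolEq μ K P v u) (i : Fin N) :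
    agentField n (x i.succ) (u i.succ) - agentField n (x 0) (u 0) =
      errorField n N μ K P (fun k => x k.succ - x 0) i := by
  set e := x i.succ - x 0
  set ρ := hnorm μ P e
  have hui : (fun _ : Fin 1 => u i.succ) = -(ρ ^ (1 + μ) • (K * dil n μ (-Real.log ρ)) *ᵥ e) := by
    ext j
    rw [Subsingleton.elim j 0, hu.2 i, (transmittedEq_iff hroot x v).1 hv i.succ]
    rfl
  have hu0 : (fun _ : Fin 1 => u 0) = 0 := funext fun _ => hu.1
  calc agentField n (x i.succ) (u i.succ) - agentField n (x 0) (u 0)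
      = matA n *ᵥ e + matB n *ᵥ (fun _ => u i.succ) := by
        rw [agentField, agentField, hu0, mulVec_zero, add_zero, mulVec_sub, add_sub_right_comm]
    _ = (matA n - ρ ^ (1 + μ) • (matB n * K * dil n μ (-Real.log ρ))) *ᵥ e := by
        rw [hui, sub_mulVec, smul_mulVec, mulVec_neg, mulVec_smul, mulVec_mulVec,
          Matrix.mul_assoc, sub_eq_add_neg]

end Protocol

lemma posDef_transpose_mul_inv_add_inv_mul {ι : Type*} [Fintype ι] [DecidableEq ι]
    {X L : Matrix ι ι ℝ} (hX : X.PosDef) (hL : (L * X + X * Lᵀ).PosDef) :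
    (Lᵀ * X⁻¹ + X⁻¹ * L).PosDef := by
  have hdet : IsUnit X.det := (isUnit_iff_isUnit_det X).1 hX.isUnit
  have hinj : Function.Injective X⁻¹.mulVec := mulVec_injective_of_isUnit hX.inv.isUnit
  convert hL.conjTranspose_mul_mul_same hinj using 1
  rw [hX.inv.isHermitian.eq, Matrix.mul_add, Matrix.add_mul, add_comm]
  congr 1
  · rw [Matrix.mul_assoc, Matrix.mul_assoc, mul_nonsing_inv X hdet, Matrix.mul_one]
  · rw [← Matrix.mul_assoc, nonsing_inv_mul X hdet, Matrix.one_mul]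

section ClosedLoop

variable {n : ℕ} {μ : ℝ}

/-- The weights of the dilation `dil n μ`, i.e. the diagonal of `genG n μ`. -/
def dilWeight (n : ℕ) (μ : ℝ) (k : Fin n) : ℝ := 1 - μ * ((n : ℝ) - ((k : ℕ) + 1 : ℝ))

lemma dil_mulVec (s : ℝ) (x : Fin n → ℝ) : dil n μ s *ᵥ x = dilation (dilWeight n μ) s x := by
  have hG : s • genG n μ = diagonal (s • dilWeight n μ) := (diagonal_smul s _).symm
  ext k
  rw [dil, hG, exp_diagonal, mulVec_diagonal, dilation_apply, Pi.coe_exp, ← Real.exp_eq_exp_ℝ]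
  rfl

lemma matA_mulVec_dilation (s : ℝ) (x : Fin n → ℝ) :
    matA n *ᵥ dilation (dilWeight n μ) s x =
      Real.exp (μ * s) • dilation (dilWeight n μ) s (matA n *ᵥ x) := by
  ext i
  simp only [mulVec, dotProduct, dilation_apply, Pi.smul_apply, smul_eq_mul, Finset.mul_sum]
  refine Finset.sum_congr rfl fun j _ => ?_
  rw [← mul_assoc (Real.exp _), ← Real.exp_add, matA, of_apply]
  split_ifs with h
  · rw [one_mul, one_mul, dilWeight, dilWeight, h]
    push_cast
    ring_nf
  · simp

lemma dilation_matB_mulVec (s : ℝ) (w : Fin 1 → ℝ) :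
    dilation (dilWeight n μ) s (matB n *ᵥ w) = Real.exp s • matB n *ᵥ w := by
  ext i
  simp only [mulVec, dotProduct, dilation_apply, Pi.smul_apply, smul_eq_mul, Finset.mul_sum]
  refine Finset.sum_congr rfl fun j _ => ?_
  rw [matB, of_apply]
  split_ifs with h
  · have hi : dilWeight n μ i = 1 := by
      have hn : ((i : ℕ) : ℝ) + 1 = n := by exact_mod_cast h
      rw [dilWeight, hn, sub_self, mul_zero, sub_zero]
    rw [hi, mul_one]
  · simp

variable {X : Matrix (Fin n) (Fin n) ℝ} {Y : Matrix (Fin 1) (Fin n) ℝ}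

/-- The closed loop of a single agent with state `eᵢ`, as a homogeneous system: on the unit sphere
its field is `A - B K`. -/
def closedLoop (hLMI : SolvesLMI n μ X Y) : HomogeneousSystem (Fin n) where
  r := dilWeight n μ
  P := X⁻¹
  M := matA n - matB n * (Y * X⁻¹)
  μ := μ
  posDef := hLMI.1.inv
  posDef_dilation := by
    have h := posDef_transpose_mul_inv_add_inv_mul (L := genG n μ) hLMI.1
    rw [genG, diagonal_transpose] at h
    exact h hLMI.2.1
  posDef_decay := by
    have hX : Xᵀ = X := by simpa using hLMI.1.isHermitian.eq
    have hdet : IsUnit X.det := (isUnit_iff_isUnit_det X).1 hLMI.1.isUnit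
    have hMX : (matA n - matB n * (Y * X⁻¹)) * X = matA n * X - matB n * Y := by
      rw [Matrix.sub_mul, Matrix.mul_assoc, Matrix.mul_assoc, nonsing_inv_mul X hdet,
        Matrix.mul_one]
    have hXM := congrArg transpose hMX
    simp only [transpose_mul, hX, transpose_sub (_ * _)] at hXM
    have h := posDef_transpose_mul_inv_add_inv_mul (L := -(matA n - matB n * (Y * X⁻¹))) hLMI.1 (by
      rw [transpose_neg, Matrix.neg_mul, Matrix.mul_neg, hMX, hXM]
      convert hLMI.2.2 using 1
      abel)
    rwa [transpose_neg, Matrix.neg_mul, Matrix.mul_neg, ← neg_add] at h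

lemma wnorm_dil_mulVec (hLMI : SolvesLMI n μ X Y) (s : ℝ) (x : Fin n → ℝ) :
    wnorm X⁻¹ (dil n μ s *ᵥ x) =
      √((closedLoop hLMI).normSq (dilation (closedLoop hLMI).r s x)) := by
  rw [dil_mulVec]
  rfl

lemma hnorm_eq_homNorm (hLMI : SolvesLMI n μ X Y) : hnorm μ X⁻¹ = (closedLoop hLMI).homNorm := by
  ext x
  simp only [hnorm, wnorm_dil_mulVec hLMI, Real.sqrt_eq_one]
  rfl

theorem strictMono_wnorm_dil (hLMI : SolvesLMI n μ X Y) {x : Fin n → ℝ} (hx : x ≠ 0) :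
    StrictMono fun s => wnorm X⁻¹ (dil n μ s *ᵥ x) := by
  intro s t hst
  simp only [wnorm_dil_mulVec hLMI]
  exact Real.sqrt_lt_sqrt ((closedLoop hLMI).normSq_pos (dilation_ne_zero hx)).le
    ((closedLoop hLMI).strictMono_normSq_dilation hx hst)

theorem existsUnique_wnorm_dil (hLMI : SolvesLMI n μ X Y) {x : Fin n → ℝ} (hx : x ≠ 0) :
    ∃! s, wnorm X⁻¹ (dil n μ (-s) *ᵥ x) = 1 := by
  simpa only [wnorm_dil_mulVec hLMI, Real.sqrt_eq_one] using
    (closedLoop hLMI).existsUnique_normSq_dilation_neg hx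

lemma mulVec_eq_field (hLMI : SolvesLMI n μ X Y) (x : Fin n → ℝ) :
    (matA n - hnorm μ X⁻¹ x ^ (1 + μ) •
      (matB n * (Y * X⁻¹) * dil n μ (-Real.log (hnorm μ X⁻¹ x)))) *ᵥ x =
    (closedLoop hLMI).field x := by
  set S := closedLoop hLMI with hS
  rcases eq_or_ne x 0 with rfl | hx
  · rw [mulVec_zero, S.field_zero]
  have hr : dilWeight n μ = S.r := rfl
  have hM : S.M = matA n - matB n * (Y * X⁻¹) := rfl
  have hμ : S.μ = μ := rfl
  have hA : matA n *ᵥ x =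
      Real.exp (μ * S.logNorm x) • dilation S.r (S.logNorm x) (matA n *ᵥ S.sphereProj x) := by
    rw [← hr, ← matA_mulVec_dilation, hr, S.dilation_logNorm_sphereProj]
  have hB : Real.exp ((1 + μ) * S.logNorm x) •
        (matB n * (Y * X⁻¹) * dil n μ (-S.logNorm x)) *ᵥ x =
      Real.exp (μ * S.logNorm x) •
        dilation S.r (S.logNorm x) ((matB n * (Y * X⁻¹)) *ᵥ S.sphereProj x) := by
    rw [← mulVec_mulVec, ← mulVec_mulVec _ (matB n), ← mulVec_mulVec (S.sphereProj x) (matB n),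
      dil_mulVec, hr, ← HomogeneousSystem.sphereProj, ← hr, dilation_matB_mulVec, smul_smul,
      ← Real.exp_add, add_mul, one_mul, add_comm (μ * _)]
  rw [hnorm_eq_homNorm hLMI, ← hS, ← hμ, S.homNorm_rpow hx, S.homNorm_of_ne_zero hx, Real.log_exp,
    hμ, sub_mulVec, smul_mulVec, hA, hB, HomogeneousSystem.field, hM, hμ, sub_mulVec, map_sub,
    smul_sub]

lemma errorField_eq_prodField (hLMI : SolvesLMI n μ X Y) (N : ℕ) :
    errorField n N μ (Y * X⁻¹) X⁻¹ = (closedLoop hLMI).prodField (Fin N) :=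
  funext fun e => funext fun i => mulVec_eq_field hLMI (e i)

lemma add_dilWeight (k : Fin n) :
    (∃ j, μ + dilWeight n μ k = dilWeight n μ j) ∨ μ + dilWeight n μ k = μ + 1 := by
  unfold dilWeight
  rcases Nat.lt_or_ge (k + 1) n with h | h
  · refine .inl ⟨⟨k + 1, h⟩, ?_⟩
    push_cast
    ring
  · have hn : ((k : ℕ) : ℝ) + 1 = n := by exact_mod_cast le_antisymm k.2 h
    exact .inr (by rw [hn]; ring)

theorem wellPosed_errorField (hLMI : SolvesLMI n μ X Y) (hμ : -1 ≤ μ) (N : ℕ) :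
    WellPosed μ (errorField n N μ (Y * X⁻¹) X⁻¹) := by
  rw [errorField_eq_prodField hLMI]
  have hpos : ∀ k, 0 < dilWeight n μ k := (closedLoop hLMI).r_pos
  refine (closedLoop hLMI).wellPosed (fun k => ?_) fun hne k => ?_
  · change 0 ≤ μ + dilWeight n μ k
    rcases add_dilWeight k with ⟨j, hj⟩ | hk
    · exact hj ▸ (hpos j).le
    · linarith
  · change 0 < μ + dilWeight n μ k
    rcases add_dilWeight k with ⟨j, hj⟩ | hk
    · exact hj ▸ hpos j
    · linarith [lt_of_le_of_ne hμ (Ne.symm hne)]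

theorem globallyFiniteTimeStable_errorField (hLMI : SolvesLMI n μ X Y) (hμ : μ < 0) (N : ℕ) :
    GloballyFiniteTimeStable μ (errorField n N μ (Y * X⁻¹) X⁻¹) := by
  rw [errorField_eq_prodField hLMI]
  exact (closedLoop hLMI).globallyFiniteTimeStable hμ

end ClosedLoop

end LeaderFollowing

end

theorem theorem1 (n N : ℕ) (hn : 1 ≤ n)
    (G : Digraph (Fin (N + 1))) (hloop : ∀ i, ¬ G.Adj i i)
    (hroot : LeaderFollowing.IsRoot G 0)
    (μ : ℝ) (hμ : -1 ≤ μ) (hμ' : μ * ((n : ℝ) - 1) < 1)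
    (X : Matrix (Fin n) (Fin n) ℝ) (Y : Matrix (Fin 1) (Fin n) ℝ)
    (hLMI : LeaderFollowing.SolvesLMI n μ X Y)
    (K : Matrix (Fin 1) (Fin n) ℝ) (hK : K = Y * X⁻¹)
    (P : Matrix (Fin n) (Fin n) ℝ) (hP : P = X⁻¹) :
    -- the canonical homogeneous norm is well defined
    (∀ x : Fin n → ℝ, x ≠ 0 →
      StrictMono (fun s : ℝ =>
        LeaderFollowing.wnorm P (Matrix.mulVec (LeaderFollowing.dil n μ s) x)) ∧
      ∃! s : ℝ, LeaderFollowing.wnorm P (Matrix.mulVec (LeaderFollowing.dil n μ (-s)) x) = 1) ∧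
    -- the averages defining the transmitted vectors are meaningful, and `v = e` is the unique
    -- solution of their equations
    (∀ i : Fin N, 0 < ∑ j, LeaderFollowing.weight G i.succ j) ∧
    (∀ x v : Fin (N + 1) → Fin n → ℝ,
      LeaderFollowing.TransmittedEq G x v ↔ ∀ i, v i = x i - x 0) ∧
    -- the inputs are uniquely determined
    (∀ x : Fin (N + 1) → Fin n → ℝ,
      ∃! p : (Fin (N + 1) → Fin n → ℝ) × (Fin (N + 1) → ℝ),
        LeaderFollowing.TransmittedEq G x p.1 ∧ LeaderFollowing.ProtocolEq μ K P p.1 p.2) ∧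
    -- the closed-loop error `eᵢ = xᵢ - x₀` is governed by the error field
    (∀ (x v : Fin (N + 1) → Fin n → ℝ) (u : Fin (N + 1) → ℝ),
      LeaderFollowing.TransmittedEq G x v → LeaderFollowing.ProtocolEq μ K P v u →
      ∀ i : Fin N,
        LeaderFollowing.agentField n (x i.succ) (u i.succ)
            - LeaderFollowing.agentField n (x 0) (u 0) =
          LeaderFollowing.errorField n N μ K P (fun k => x k.succ - x 0) i) ∧
    -- the closed-loop error system is well posed
    LeaderFollowing.WellPosed μ (LeaderFollowing.errorField n N μ K P) ∧
    -- and globally finite-time stable for negative degree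
    (μ < 0 →
      LeaderFollowing.GloballyFiniteTimeStable μ (LeaderFollowing.errorField n N μ K P)) := by
  subst hK hP
  exact ⟨fun x hx => ⟨LeaderFollowing.strictMono_wnorm_dil hLMI hx,
      LeaderFollowing.existsUnique_wnorm_dil hLMI hx⟩,
    fun i => LeaderFollowing.sum_weight_pos hroot (Fin.succ_ne_zero i),
    LeaderFollowing.transmittedEq_iff hroot,
    LeaderFollowing.existsUnique_transmittedEq_protocolEq hroot μ _ _,
    fun x v u hv hu i => LeaderFollowing.agentField_sub_eq_errorField hroot hv hu i,
    LeaderFollowing.wellPosed_errorField hLMI hμ N,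
    fun hneg => LeaderFollowing.globallyFiniteTimeStable_errorField hLMI hneg N⟩
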